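/- Let $k\ge 1$, let $c(x)=x^3+c_2x^2+c_1x+c_0\in\mathbb R[x]$ be a monic cubic such that $P(x,y)=xy-c(x)$ is irreducible (equivalently $c_0\neq 0$), and let $C=\{P=0\}\subset\mathbb R^2$, with vanishing ideal $I\subset\mathbb R[x,y]$ and coordinate ring $\mathbb R[C]=\mathbb R[x,y]/I$. Write $\mathbb R[C]_{\le m}$ for the image of $\mathbb R[x,y]_{\le m}$ (total degree at most $m$) in $\mathbb R[C]$, and $I_{\le m}=I\cap\mathbb R[x,y]_{\le m}$. Let $V^{(k)}\subset\mathbb R[C]$ be the linear span of $$\big(\{x^ay^b: 0\le a\le 2,\ b\ge 0,\ a+b\le k\}\setminus\{y^k\}\big)\cup\{y^k-2x^{2k}\};$$ products of two elements of $V^{(k)}$ lie in $\mathbb R[C]_{\le 2k}$. Let $\Phi:\mathbb R[C]\to\mathbb R[t,t^{-1}]$ be the homomorphism $\Phi(p(x,y))=p\big(t,\tfrac{c(t)}{t}\big)$, let $d_k(t)=c(t)^k-2t^{3k}$, and $$\mathcal B_{\mathcal Q}=\Big\{\tfrac{c^k}{t^k},\tfrac{c^{k-1}}{t^{k-1}},\dots,\tfrac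 ct,1,t,\dots,t^{2k-1}\Big\},\qquad \mathcal B_{\mathcal R}=\Big\{\tfrac{d_k}{t^k},\tfrac{c^{k-1}}{t^{k-1}},\dots,\tfrac ct,1,t,\dots,t^{2k-1}\Big\}.$$ Let $L:\mathbb R[x,y]_{\le 2k}\to\mathbb R$ be a linear functional vanishing on $I_{\le 2k}$, let $L_C:\mathbb R[C]_{\le 2k}\to\mathbb R$ be the induced functional, and let $$\overline L(p,q)=L(pq)\ \text{ on }\mathbb R[x,y]_{\le k},\qquad \overline L_C(f,g)=L_C(fg)\ \text{ on }\mathbb R[C]_{\le k},\qquad \overline L_{C,V^{(k)},1}(g,h)=L_C(gh)\ \text{ on }V^{(k)}.$$ Assume that $L$ is $C$-singular, i.e. it is not the case that both $\ker\overline L=I_{\le k}$ and $\ker\overline L_{C,V^{(k)},1}=\{0\}$. Then the following are equivalent: 1. $L$ is a $C$-moment functional, i.e. there is a positive Borel measure $\mu$ on $\mathbb R^2$ supported on $C$ such that every $p\in\mathbb R[x,y]_{\le 2k}$ is $\mu$-integrable and $L(p)=\int_C p\,d\mu$. 2. $L_C$ is square positive ($L_C(f^2)\ge 0$ for all $f\in\mathbb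 R[C]_{\le k}$) and $(V^{(k)},1)$-locally square positive ($L_C(g^2)\ge 0$ for all $g\in V^{(k)}$), and at least one of the following holds: (a) for $U=\operatorname{Lin}\big(\Phi^{-1}(\mathcal B_{\mathcal Q}\setminus\{c^k/t^k\})\big)$ one has $\operatorname{rank}\overline L_C=\operatorname{rank}\big(\overline L_C|_U\big)$; (b) for $W=\operatorname{Lin}\big(\Phi^{-1}(\mathcal B_{\mathcal R}\setminus\{d_k/t^k\})\big)$ one has $\operatorname{rank}\overline L_{C,V^{(k)},1}=\operatorname{rank}\big(\overline L_{C,V^{(k)},1}|_W\big)$. -/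

import Mathlib

open scoped LaurentPolynomial

noncomputable section

namespace CubicTMP

/-! ### Truncated functionals on a plane set -/

/-- `ℝ[x,y]_{≤ m}`: bivariate real polynomials of total degree at most `m`. -/
abbrev PolyLE (m : ℕ) : Submodule ℝ (MvPolynomial (Fin 2) ℝ) :=
  MvPolynomial.restrictTotalDegree (Fin 2) ℝ m

/-- The vanishing ideal of a plane set `S`. -/
abbrev vanIdeal (S : Set (Fin 2 → ℝ)) : Ideal (MvPolynomial (Fin 2) ℝ) :=
  MvPolynomial.vanishingIdeal ℝ S

/-- `ℝ[S] = ℝ[x,y] / I(S)`, the ring of polynomial functions on `S`. -/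
abbrev CoordRing (S : Set (Fin 2 → ℝ)) : Type :=
  MvPolynomial (Fin 2) ℝ ⧸ vanIdeal S

/-- The restriction map `ℝ[x,y] → ℝ[S]`. -/
abbrev resMap (S : Set (Fin 2 → ℝ)) : MvPolynomial (Fin 2) ℝ →ₐ[ℝ] CoordRing S :=
  Ideal.Quotient.mkₐ ℝ (vanIdeal S)

/-- `ℝ[S]_{≤ m}`, the image of `ℝ[x,y]_{≤ m}` in `ℝ[S]`. -/
def CoordLE (S : Set (Fin 2 → ℝ)) (m : ℕ) : Submodule ℝ (CoordRing S) :=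
  (PolyLE m).map (resMap S).toLinearMap

/-- `I(S)_{≤ m}`, as a subspace of `ℝ[x,y]_{≤ m}`. -/
def idealLE (S : Set (Fin 2 → ℝ)) (m : ℕ) : Submodule ℝ (PolyLE m) :=
  ((vanIdeal S).restrictScalars ℝ).comap (PolyLE m).subtype

/-- `L` is an `S`-moment functional: it is integration against a (positive) Borel measure on the
plane which is carried by `S`, all polynomials of the relevant degree being integrable. -/
def IsMomentFunctional (S : Set (Fin 2 → ℝ)) {m : ℕ} (L : PolyLE m →ₗ[ℝ] ℝ) : Prop :=
  ∃ μ : MeasureTheory.Measure (Fin 2 → ℝ), μ Sᶜ = 0 ∧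
    ∀ p : PolyLE m,
      MeasureTheory.Integrable (fun z => MvPolynomial.eval z (p : MvPolynomial (Fin 2) ℝ)) μ ∧
      L p = ∫ z, MvPolynomial.eval z (p : MvPolynomial (Fin 2) ℝ) ∂μ

/-- `L` vanishes on `I(S)_{≤ m}`, i.e. the induced functional on `ℝ[S]_{≤ m}` is well defined. -/
def VanishesOnIdeal (S : Set (Fin 2 → ℝ)) {m : ℕ} (L : PolyLE m →ₗ[ℝ] ℝ) : Prop :=
  idealLE S m ≤ LinearMap.ker L

theorem mul_mem_polyLE {a b : ℕ} {p q : MvPolynomial (Fin 2) ℝ}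
    (hp : p ∈ PolyLE a) (hq : q ∈ PolyLE b) : p * q ∈ PolyLE (a + b) := by
  rw [MvPolynomial.mem_restrictTotalDegree] at *
  exact (MvPolynomial.totalDegree_mul p q).trans (add_le_add hp hq)

theorem mul_mem_coordLE {S : Set (Fin 2 → ℝ)} {a b : ℕ} {f g : CoordRing S}
    (hf : f ∈ CoordLE S a) (hg : g ∈ CoordLE S b) : f * g ∈ CoordLE S (a + b) := by
  obtain ⟨p, hp, rfl⟩ := hf
  obtain ⟨q, hq, rfl⟩ := hg
  exact ⟨p * q, mul_mem_polyLE hp hq, map_mul (resMap S) p q⟩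

theorem coordLE_mono (S : Set (Fin 2 → ℝ)) {a b : ℕ} (h : a ≤ b) : CoordLE S a ≤ CoordLE S b := by
  rintro _ ⟨p, hp, rfl⟩
  refine ⟨p, ?_, rfl⟩
  simp only [SetLike.mem_coe, MvPolynomial.mem_restrictTotalDegree] at *
  omega

/-- The restriction map `ℝ[x,y]_{≤ m} → ℝ[S]_{≤ m}`. -/
def resLE (S : Set (Fin 2 → ℝ)) (m : ℕ) : PolyLE m →ₗ[ℝ] CoordLE S m :=
  (resMap S).toLinearMap.restrict fun p hp => ⟨p, hp, rfl⟩

theorem resLE_surjective (S : Set (Fin 2 → ℝ)) (m : ℕ) : Function.Surjective (resLE S m) := by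
  rintro ⟨_, p, hp, rfl⟩
  exact ⟨⟨p, hp⟩, rfl⟩

theorem ker_resLE (S : Set (Fin 2 → ℝ)) (m : ℕ) : LinearMap.ker (resLE S m) = idealLE S m := by
  ext p
  rw [LinearMap.mem_ker, Subtype.ext_iff]
  exact Ideal.Quotient.eq_zero_iff_mem

/-- The induced functional `L_S : ℝ[S]_{≤ m} → ℝ`, `L_S (p + I(S)) = L p`. -/
def inducedFunctional {S : Set (Fin 2 → ℝ)} {m : ℕ} (L : PolyLE m →ₗ[ℝ] ℝ)
    (hL : VanishesOnIdeal S L) : CoordLE S m →ₗ[ℝ] ℝ :=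
  ((LinearMap.ker (resLE S m)).liftQ L (by rw [ker_resLE]; exact hL)).comp
    ((resLE S m).quotKerEquivOfSurjective (resLE_surjective S m)).symm.toLinearMap

theorem inducedFunctional_resLE {S : Set (Fin 2 → ℝ)} {m : ℕ} (L : PolyLE m →ₗ[ℝ] ℝ)
    (hL : VanishesOnIdeal S L) (p : PolyLE m) : inducedFunctional L hL (resLE S m p) = L p := by
  simp [inducedFunctional, LinearMap.quotKerEquivOfSurjective_symm_apply]

/-! ### The bilinear forms -/

/-- The bilinear form `(p, q) ↦ L (p q)` on `ℝ[x,y]_{≤ k}`. -/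
def polyForm {k : ℕ} (L : PolyLE (2 * k) →ₗ[ℝ] ℝ) : LinearMap.BilinForm ℝ (PolyLE k) :=
  LinearMap.mk₂ ℝ
    (fun p q => L ⟨(p : MvPolynomial (Fin 2) ℝ) * q, two_mul k ▸ mul_mem_polyLE p.2 q.2⟩)
    (fun p p' q => by rw [← map_add]; congr 1; ext1; simp [add_mul])
    (fun a p q => by rw [← map_smul]; congr 1; ext1; simp)
    (fun p q q' => by rw [← map_add]; congr 1; ext1; simp [mul_add])
    (fun a p q => by rw [← map_smul]; congr 1; ext1; simp)

/-- For a functional `ℓ` on `ℝ[S]_{≤ n}`, a subspace `V` of `ℝ[S]` and `f ∈ ℝ[S]` such that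
`f g h ∈ ℝ[S]_{≤ n}` for all `g, h ∈ V`: the bilinear form `(g, h) ↦ ℓ (f g h)` on `V`. -/
def localForm {S : Set (Fin 2 → ℝ)} {n : ℕ} (ℓ : CoordLE S n →ₗ[ℝ] ℝ)
    (V : Submodule ℝ (CoordRing S)) (f : CoordRing S)
    (hV : ∀ g ∈ V, ∀ h ∈ V, f * (g * h) ∈ CoordLE S n) : LinearMap.BilinForm ℝ V :=
  LinearMap.mk₂ ℝ
    (fun g h => ℓ ⟨f * ((g : CoordRing S) * h), hV g g.2 h h.2⟩)
    (fun g g' h => by rw [← map_add]; congr 1; ext1; simp [add_mul, mul_add])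
    (fun a g h => by rw [← map_smul]; congr 1; ext1; simp [smul_mul_assoc, mul_smul_comm])
    (fun g h h' => by rw [← map_add]; congr 1; ext1; simp [mul_add])
    (fun a g h => by rw [← map_smul]; congr 1; ext1; simp [mul_smul_comm])

theorem one_mul_mul_mem_coordLE {S : Set (Fin 2 → ℝ)} {k : ℕ} :
    ∀ g ∈ CoordLE S k, ∀ h ∈ CoordLE S k, 1 * (g * h) ∈ CoordLE S (2 * k) := by
  intro g hg h hh
  rw [one_mul, two_mul]
  exact mul_mem_coordLE hg hh

/-- The bilinear form `(f, g) ↦ ℓ (f g)` on `ℝ[S]_{≤ k}`. -/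
def coordForm {S : Set (Fin 2 → ℝ)} {k : ℕ} (ℓ : CoordLE S (2 * k) →ₗ[ℝ] ℝ) :
    LinearMap.BilinForm ℝ (CoordLE S k) :=
  localForm ℓ (CoordLE S k) 1 one_mul_mul_mem_coordLE

/-- `B(g, g) ≥ 0` for every `g ≠ 0`. For `coordForm` this is square positivity, and for
`localForm ℓ V f` it is `(V, f)`-local square positivity. -/
def SquarePositive {E : Type*} [AddCommGroup E] [Module ℝ E] (B : LinearMap.BilinForm ℝ E) : Prop :=
  ∀ g : E, g ≠ 0 → 0 ≤ B g g

/-- The kernel `{v | B(u, v) = 0 for all u}` of a bilinear form. -/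
def formKer {E : Type*} [AddCommGroup E] [Module ℝ E] (B : LinearMap.BilinForm ℝ E) :
    Submodule ℝ E :=
  LinearMap.ker (LinearMap.flip B)

/-- The rank of a bilinear form on `E`, i.e. the rank of the map `E → E*` it defines. -/
def formRank {E : Type*} [AddCommMonoid E] [Module ℝ E] (B : LinearMap.BilinForm ℝ E) : Cardinal :=
  LinearMap.rank B

/-- The restriction of a bilinear form on `V` to a subspace `U ⊆ V`, both `U` and `V` being given
as subspaces of an ambient space. -/
def formRestrict {E : Type*} [AddCommGroup E] [Module ℝ E] {V : Submodule ℝ E}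
    (B : LinearMap.BilinForm ℝ V) (U : Submodule ℝ E) :
    LinearMap.BilinForm ℝ (U.comap V.subtype) :=
  LinearMap.BilinForm.restrict B (U.comap V.subtype)

/-! ### The curve `x y = c(x)` -/

/-- The polynomial `x y - c(x)`. -/
def curvePoly (c : Polynomial ℝ) : MvPolynomial (Fin 2) ℝ :=
  MvPolynomial.X 0 * MvPolynomial.X 1 - Polynomial.aeval (MvPolynomial.X 0) c

/-- The zero set of `x y - c(x)` in the plane. -/
def curve (c : Polynomial ℝ) : Set (Fin 2 → ℝ) :=
  {z | MvPolynomial.eval z (curvePoly c) = 0}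

/-- The coordinate function `x` on the curve. -/
def xC (c : Polynomial ℝ) : CoordRing (curve c) := resMap (curve c) (MvPolynomial.X 0)

/-- The coordinate function `y` on the curve. -/
def yC (c : Polynomial ℝ) : CoordRing (curve c) := resMap (curve c) (MvPolynomial.X 1)

/-- The family `1, x, y, x², xy, y², …, x²y^{k-2}, xy^{k-1}, y^k`. -/
def basisSet (c : Polynomial ℝ) (k : ℕ) : Set (CoordRing (curve c)) :=
  {f | ∃ a b : ℕ, a ≤ 2 ∧ a + b ≤ k ∧ f = xC c ^ a * yC c ^ b}

/-- The space `V^{(k)}`, spanned by `basisSet` with `y^k` replaced by `y^k - 2 x^{2k}`. -/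
def Vk (c : Polynomial ℝ) (k : ℕ) : Submodule ℝ (CoordRing (curve c)) :=
  Submodule.span ℝ ((basisSet c k \ {yC c ^ k}) ∪ {yC c ^ k - 2 * xC c ^ (2 * k)})

/-- The relation `x y = c(x)` in the coordinate ring. -/
theorem xC_mul_yC (c : Polynomial ℝ) : xC c * yC c = Polynomial.aeval (xC c) c := by
  have h : curvePoly c ∈ vanIdeal (curve c) := by
    rw [MvPolynomial.mem_vanishingIdeal_iff]
    intro z hz
    rw [MvPolynomial.aeval_eq_eval]
    exact hz
  have h2 : resMap (curve c) (curvePoly c) = 0 := Ideal.Quotient.eq_zero_iff_mem.2 h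
  rw [curvePoly, map_sub, map_mul, ← Polynomial.aeval_algHom_apply, sub_eq_zero] at h2
  exact h2

theorem monomial_mem_coordLE (c : Polynomial ℝ) {a b k : ℕ} (h : a + b ≤ k) :
    xC c ^ a * yC c ^ b ∈ CoordLE (curve c) k := by
  refine ⟨MvPolynomial.X 0 ^ a * MvPolynomial.X 1 ^ b, ?_, ?_⟩
  · simp only [SetLike.mem_coe, MvPolynomial.mem_restrictTotalDegree]
    refine (MvPolynomial.totalDegree_mul _ _).trans ?_
    rw [MvPolynomial.totalDegree_X_pow, MvPolynomial.totalDegree_X_pow]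
    exact h
  · simp [xC, yC]

theorem xC_pow_mem (c : Polynomial ℝ) (hc : c.Monic) (hd : c.natDegree = 3) (m : ℕ) :
    ∀ j < 2 * m, xC c ^ j ∈ CoordLE (curve c) m := by
  induction m with
  | zero => intro j hj; omega
  | succ m ih =>
    have hx : xC c ∈ CoordLE (curve c) 1 := by
      simpa using monomial_mem_coordLE c (a := 1) (b := 0) (k := 1) le_rfl
    have hy : yC c ∈ CoordLE (curve c) 1 := by
      simpa using monomial_mem_coordLE c (a := 0) (b := 1) (k := 1) le_rfl
    have hlow : ∀ j < 2 * m + 1, xC c ^ j ∈ CoordLE (curve c) (m + 1) := by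
      intro j hj
      rcases j with _ | j
      · exact coordLE_mono _ (Nat.zero_le _)
          (by simpa using monomial_mem_coordLE c (a := 0) (b := 0) (k := 0) le_rfl)
      · rw [pow_succ]
        exact mul_mem_coordLE (ih j (by omega)) hx
    intro j hj
    by_cases hj' : j < 2 * m + 1
    · exact hlow j hj'
    obtain rfl : j = 2 * m + 1 := by omega
    rcases m with _ | m
    · simpa using hx
    have h3 : xC c ^ 3 = xC c * yC c - c.coeff 2 • xC c ^ 2 - c.coeff 1 • xC c ^ 1
        - c.coeff 0 • xC c ^ 0 := by
      have h1 : c.coeff 3 = 1 := hd ▸ hc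
      rw [xC_mul_yC, Polynomial.aeval_eq_sum_range, hd]
      simp only [Finset.sum_range_succ, Finset.sum_range_zero, h1, one_smul]
      abel
    have h4 : xC c ^ (2 * (m + 1) + 1) = xC c ^ (2 * m + 1) * yC c
        - c.coeff 2 • xC c ^ (2 * m + 2) - c.coeff 1 • xC c ^ (2 * m + 1)
        - c.coeff 0 • xC c ^ (2 * m) := by
      have : xC c ^ (2 * (m + 1) + 1) = xC c ^ (2 * m) * xC c ^ 3 := by ring
      rw [this, h3]
      simp only [mul_sub, mul_smul_comm, ← pow_add, add_zero]
      ring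
    rw [h4]
    refine sub_mem (sub_mem (sub_mem ?_ ?_) ?_) ?_
    · exact mul_mem_coordLE (ih _ (by omega)) hy
    · exact Submodule.smul_mem _ _ (hlow _ (by omega))
    · exact Submodule.smul_mem _ _ (hlow _ (by omega))
    · exact Submodule.smul_mem _ _ (hlow _ (by omega))

theorem aeval_xC_mem (c : Polynomial ℝ) (hc : c.Monic) (hd : c.natDegree = 3) (m : ℕ)
    (q : Polynomial ℝ) (hq : q.natDegree < 2 * m) :
    Polynomial.aeval (xC c) q ∈ CoordLE (curve c) m := by
  rw [Polynomial.aeval_eq_sum_range]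
  refine Submodule.sum_mem _ fun i hi => Submodule.smul_mem _ _ (xC_pow_mem c hc hd m i ?_)
  rw [Finset.mem_range] at hi
  omega

theorem yC_pow_mul_xC_pow (c : Polynomial ℝ) (a b : ℕ) :
    xC c ^ (a + b) * yC c ^ b = Polynomial.aeval (xC c) (Polynomial.X ^ a * c ^ b) := by
  rw [pow_add, mul_assoc, ← mul_pow, xC_mul_yC]
  simp

/-- Products of two elements of `V^{(k)}` lie in `ℝ[C]_{≤ 2k}`. -/
theorem one_mul_mul_mem_of_Vk (c : Polynomial ℝ) (hc : c.Monic) (hd : c.natDegree = 3) {k : ℕ}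
    (hk : 1 ≤ k) :
    ∀ g ∈ Vk c k, ∀ h ∈ Vk c k, 1 * (g * h) ∈ CoordLE (curve c) (2 * k) := by
  have hmix : ∀ s ∈ basisSet c k \ {yC c ^ k},
      s * (yC c ^ k - 2 * xC c ^ (2 * k)) ∈ CoordLE (curve c) (2 * k) := by
    rintro s ⟨⟨a, b, ha, hab, rfl⟩, hne⟩
    have hb : b < k := by
      by_contra hb
      obtain rfl : a = 0 := by omega
      obtain rfl : b = k := by omega
      simp at hne
    have e : xC c ^ a * yC c ^ b * (yC c ^ k - 2 * xC c ^ (2 * k)) =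
        xC c ^ a * yC c ^ (b + k) -
          (2 : ℝ) • Polynomial.aeval (xC c) (Polynomial.X ^ (2 * k + a - b) * c ^ b) := by
      rw [← yC_pow_mul_xC_pow, show 2 * k + a - b + b = 2 * k + a by omega, two_smul]
      ring
    rw [e]
    refine sub_mem (monomial_mem_coordLE c (by omega)) (Submodule.smul_mem _ _ ?_)
    apply aeval_xC_mem c hc hd
    refine lt_of_le_of_lt Polynomial.natDegree_mul_le ?_
    rw [Polynomial.natDegree_X_pow, hc.natDegree_pow, hd]
    omega
  have hww : (yC c ^ k - 2 * xC c ^ (2 * k)) * (yC c ^ k - 2 * xC c ^ (2 * k)) ∈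
      CoordLE (curve c) (2 * k) := by
    have e : (yC c ^ k - 2 * xC c ^ (2 * k)) * (yC c ^ k - 2 * xC c ^ (2 * k)) =
        xC c ^ 0 * yC c ^ (2 * k) - (4 : ℝ) • Polynomial.aeval (xC c)
          (Polynomial.X ^ k * c ^ k - Polynomial.X ^ (4 * k)) := by
      rw [map_sub, ← yC_pow_mul_xC_pow, map_pow, Polynomial.aeval_X,
        show (4 : ℝ) = ((4 : ℕ) : ℝ) by norm_num, Nat.cast_smul_eq_nsmul, nsmul_eq_mul]
      push_cast
      ring
    rw [e]
    refine sub_mem (monomial_mem_coordLE c (by omega)) (Submodule.smul_mem _ _ ?_)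
    apply aeval_xC_mem c hc hd
    have hm : (Polynomial.X ^ k * c ^ k : Polynomial ℝ).Monic :=
      (Polynomial.monic_X_pow k).mul (hc.pow k)
    have hn : (Polynomial.X ^ k * c ^ k : Polynomial ℝ).natDegree = 4 * k := by
      rw [(Polynomial.monic_X_pow k).natDegree_mul (hc.pow k), Polynomial.natDegree_X_pow,
        hc.natDegree_pow, hd]
      ring
    have hlt := Polynomial.degree_sub_lt_left (p := Polynomial.X ^ k * c ^ k)
      (q := (Polynomial.X ^ (4 * k) : Polynomial ℝ))
      (by rw [Polynomial.degree_X_pow, Polynomial.degree_eq_natDegree hm.ne_zero, hn]) hm.ne_zero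
      (by rw [hm.leadingCoeff, (Polynomial.monic_X_pow _).leadingCoeff])
    by_cases h0 : (Polynomial.X ^ k * c ^ k - Polynomial.X ^ (4 * k) : Polynomial ℝ) = 0
    · rw [h0, Polynomial.natDegree_zero]
      omega
    · have := Polynomial.natDegree_lt_natDegree h0 hlt
      omega
  have hle : Vk c k * Vk c k ≤ CoordLE (curve c) (2 * k) := by
    rw [Vk, Submodule.span_mul_span, Submodule.span_le]
    rintro _ ⟨s, hs, t, ht, rfl⟩
    simp only [Set.mem_union, Set.mem_singleton_iff] at hs ht
    rcases hs with hs | rfl <;> rcases ht with ht | rfl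
    · obtain ⟨⟨a, b, -, hab, rfl⟩, -⟩ := hs
      obtain ⟨⟨a', b', -, hab', rfl⟩, -⟩ := ht
      rw [two_mul]
      exact mul_mem_coordLE (monomial_mem_coordLE c hab) (monomial_mem_coordLE c hab')
    · exact hmix s hs
    · have h := hmix t ht
      rw [mul_comm t] at h
      exact h
    · exact hww
  intro g hg h hh
  rw [one_mul]
  exact hle (Submodule.mul_mem_mul hg hh)

/-- The `(V^{(k)}, 1)`-localized bilinear form `(g, h) ↦ ℓ (g h)` on `V^{(k)}`. -/
def VkForm {c : Polynomial ℝ} (hc : c.Monic) (hd : c.natDegree = 3) {k : ℕ} (hk : 1 ≤ k)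
    (ℓ : CoordLE (curve c) (2 * k) →ₗ[ℝ] ℝ) : LinearMap.BilinForm ℝ (Vk c k) :=
  localForm ℓ (Vk c k) 1 (one_mul_mul_mem_of_Vk c hc hd hk)

/-- `L` (whose induced functional on `ℝ[C]_{≤ 2k}` is well defined) is `C`-nonsingular: the kernel
of the form `(p, q) ↦ L (p q)` on `ℝ[x,y]_{≤ k}` is `I(C)_{≤ k}`, and the kernel of the
`(V^{(k)}, 1)`-localized form is zero. -/
def IsNonsingular {c : Polynomial ℝ} (hc : c.Monic) (hd : c.natDegree = 3) {k : ℕ} (hk : 1 ≤ k)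
    (L : PolyLE (2 * k) →ₗ[ℝ] ℝ) (hL : VanishesOnIdeal (curve c) L) : Prop :=
  formKer (polyForm L) = idealLE (curve c) k ∧
    formKer (VkForm hc hd hk (inducedFunctional L hL)) = ⊥

/-- The Laurent polynomial `c(t) / t`. -/
def cDivT (c : Polynomial ℝ) : ℝ[T;T⁻¹] :=
  Polynomial.toLaurent c * LaurentPolynomial.T (-1)

/-- `p(x,y) ↦ p(t, c(t)/t)` on polynomials. -/
def preParam (c : Polynomial ℝ) : MvPolynomial (Fin 2) ℝ →ₐ[ℝ] ℝ[T;T⁻¹] :=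
  MvPolynomial.aeval ![LaurentPolynomial.T 1, cDivT c]

theorem eval_preParam (c : Polynomial ℝ) (u : ℝˣ) (p : MvPolynomial (Fin 2) ℝ) :
    LaurentPolynomial.eval₂ (RingHom.id ℝ) u (preParam c p) =
      MvPolynomial.eval ![(u : ℝ), c.eval (u : ℝ) * (u : ℝ)⁻¹] p := by
  induction p using MvPolynomial.induction_on with
  | C a =>
    simp only [preParam, MvPolynomial.aeval_C, MvPolynomial.eval_C]
    rw [← LaurentPolynomial.C_eq_algebraMap, LaurentPolynomial.eval₂_C, RingHom.id_apply]
  | add p q hp hq => simp only [map_add, hp, hq]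
  | mul_X p i hp =>
    rw [map_mul, map_mul, map_mul, hp]
    congr 1
    fin_cases i
    · simp [preParam, LaurentPolynomial.eval₂_T]
    · simp only [preParam, cDivT, MvPolynomial.aeval_X, MvPolynomial.eval_X]
      simp [LaurentPolynomial.eval₂_T, LaurentPolynomial.eval₂_toLaurent, Polynomial.eval₂_id]

theorem laurent_eq_zero_of_eval {f : ℝ[T;T⁻¹]}
    (h : ∀ u : ℝˣ, LaurentPolynomial.eval₂ (RingHom.id ℝ) u f = 0) : f = 0 := by
  obtain ⟨n, g, hg⟩ := f.exists_T_pow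
  have hg0 : g = 0 := by
    apply Polynomial.eq_zero_of_infinite_isRoot
    refine Set.Infinite.mono (s := Set.Ioi (0 : ℝ)) ?_ (Set.Ioi_infinite 0)
    intro t ht
    have hh := congrArg (LaurentPolynomial.eval₂ (RingHom.id ℝ) (Units.mk0 t (ne_of_gt ht))) hg
    rw [map_mul, h, zero_mul, LaurentPolynomial.eval₂_toLaurent, Polynomial.eval₂_id] at hh
    exact hh
  rw [hg0, map_zero] at hg
  exact ((LaurentPolynomial.isUnit_T (R := ℝ) (n : ℤ)).mul_left_eq_zero).1 hg.symm

theorem curve_param_mem (c : Polynomial ℝ) (u : ℝˣ) :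
    ![(u : ℝ), c.eval (u : ℝ) * (u : ℝ)⁻¹] ∈ curve c := by
  have h : ∀ z : Fin 2 → ℝ, MvPolynomial.eval z (Polynomial.aeval (MvPolynomial.X 0) c) =
      c.eval (z 0) := by
    intro z
    rw [← MvPolynomial.coe_aeval_eq_eval, RingHom.coe_coe, ← Polynomial.aeval_algHom_apply]
    simp [Polynomial.aeval_def, Polynomial.eval₂_id]
  have hu : (u : ℝ) ≠ 0 := u.ne_zero
  simp only [curve, curvePoly, Set.mem_ofPred_eq, map_sub, map_mul, MvPolynomial.eval_X, h]
  simp only [Matrix.cons_val_zero, Matrix.cons_val_one]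
  field_simp
  ring

theorem preParam_eq_zero (c : Polynomial ℝ) (p : MvPolynomial (Fin 2) ℝ)
    (hp : p ∈ vanIdeal (curve c)) : preParam c p = 0 := by
  apply laurent_eq_zero_of_eval
  intro u
  rw [eval_preParam]
  have := (MvPolynomial.mem_vanishingIdeal_iff.1 hp) _ (curve_param_mem c u)
  rwa [MvPolynomial.aeval_eq_eval] at this

/-- The homomorphism `Φ : ℝ[C] → ℝ[t, t⁻¹]`, `Φ(p(x,y)) = p(t, c(t)/t)`. -/
def Phi (c : Polynomial ℝ) : CoordRing (curve c) →ₐ[ℝ] ℝ[T;T⁻¹] :=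
  Ideal.Quotient.liftₐ (vanIdeal (curve c)) (preParam c) (preParam_eq_zero c)

/-- `(c/t)^k, (c/t)^{k-1}, …, c/t, 1, t, …, t^{2k-1}`. -/
def basisQ (c : Polynomial ℝ) (k : ℕ) : Set ℝ[T;T⁻¹] :=
  {f | ∃ j : ℕ, 1 ≤ j ∧ j ≤ k ∧ f = cDivT c ^ j} ∪
    {f | ∃ j : ℕ, j < 2 * k ∧ f = LaurentPolynomial.T (j : ℤ)}

/-- `d_k(t) / t^k`, where `d_k(t) = c(t)^k - 2 t^{3k}`. -/
def dDivT (c : Polynomial ℝ) (k : ℕ) : ℝ[T;T⁻¹] :=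
  Polynomial.toLaurent (c ^ k - 2 * Polynomial.X ^ (3 * k)) * LaurentPolynomial.T (-(k : ℤ))

/-- `d_k/t^k, (c/t)^{k-1}, …, c/t, 1, t, …, t^{2k-1}`. -/
def basisR (c : Polynomial ℝ) (k : ℕ) : Set ℝ[T;T⁻¹] :=
  {dDivT c k} ∪ {f | ∃ j : ℕ, 1 ≤ j ∧ j < k ∧ f = cDivT c ^ j} ∪
    {f | ∃ j : ℕ, j < 2 * k ∧ f = LaurentPolynomial.T (j : ℤ)}

/-- `U`, the span of `Φ⁻¹(basisQ \ {c^k/t^k})`. -/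
def Uk (c : Polynomial ℝ) (k : ℕ) : Submodule ℝ (CoordRing (curve c)) :=
  Submodule.span ℝ (Phi c ⁻¹' (basisQ c k \ {cDivT c ^ k}))

/-- `W`, the span of `Φ⁻¹(basisR \ {d_k/t^k})`. -/
def Wk (c : Polynomial ℝ) (k : ℕ) : Submodule ℝ (CoordRing (curve c)) :=
  Submodule.span ℝ (Phi c ⁻¹' (basisR c k \ {dDivT c k}))

end CubicTMP

end

/-!
Through `Φ` the coordinate ring of the curve becomes the ring of Laurent polynomials. The two spaces
`ℝ[C]_{≤ k}` and `V^{(k)}` become the Laurent polynomials with exponents in `[-k, 2k]` whose extreme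
coefficients have ratio `γ = c₀ ^ k`, respectively `-γ`, and `U`, `W` become those with exponents in
`[-k + 1, 2k - 1]`. So a rank condition says that the form on the space with ratio `s = ±γ` has a
kernel vector `f` with nonzero leading coefficient.

Given such an `f`, every Laurent polynomial is `r + f m` with `r` in the space with ratio `-s`.
Hence the functional, extended by zero to the ideal `(f)`, is positive on all squares, and as `(f)`
has finitely many zeros, the one-variable real Nullstellensatz makes it a nonnegative combination of
point evaluations. Conversely, if `L` is a moment functional, a kernel vector vanishes almost
everywhere, and so do its multiples; among them is one with nonzero leading coefficient.
-/

noncomputable section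

namespace CubicTMP

/-! ### Positive functionals and real ideals -/

/-- A real ideal: if a sum of squares lies in it, then so does each summand. -/
def IsRealIdeal {A : Type*} [CommRing A] (I : Ideal A) : Prop :=
  ∀ a s : A, IsSumSq s → a * a + s ∈ I → a ∈ I

theorem map_isSumSq {A B : Type*} [Semiring A] [Semiring B] (φ : A →+* B) {s : A}
    (hs : IsSumSq s) : IsSumSq (φ s) := by
  induction hs with
  | zero => rw [map_zero]; exact .zero
  | sq_add a _ ih => rw [map_add, map_mul]; exact .sq_add _ ih

theorem IsRealIdeal.comap {A B : Type*} [CommRing A] [CommRing B] {I : Ideal B}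
    (hI : IsRealIdeal I) (φ : A →+* B) : IsRealIdeal (I.comap φ) := fun a s hs has =>
  hI (φ a) (φ s) (map_isSumSq φ hs) (by simpa only [Ideal.mem_comap, map_add, map_mul] using has)

theorem IsRealIdeal.isRadical {A : Type*} [CommRing A] {I : Ideal A} (hI : IsRealIdeal I) :
    I.IsRadical := by
  rw [Ideal.isRadical_iff_pow_one_lt 2 one_lt_two]
  exact fun a ha => hI a 0 .zero (by simpa [sq] using ha)

/-- The largest ideal contained in the kernel of a functional on an algebra. -/
def nullIdeal {R A : Type*} [CommSemiring R] [CommSemiring A] [Algebra R A] (ℓ : A →ₗ[R] R) :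
    Ideal A where
  carrier := {a | ∀ b, ℓ (a * b) = 0}
  add_mem' ha hb c := by rw [add_mul, map_add, ha c, hb c, add_zero]
  zero_mem' b := by rw [zero_mul, map_zero]
  smul_mem' c a ha b := by rw [smul_eq_mul, mul_comm c, mul_assoc, ha]

section PositiveFunctional

variable {R A : Type*} [CommRing R] [LinearOrder R] [IsStrictOrderedRing R] [CommRing A]
  [Algebra R A] {ℓ : A →ₗ[R] R}

theorem mem_nullIdeal_of_apply_mul_self_eq_zero (hℓ : ∀ a, 0 ≤ ℓ (a * a)) {a : A}
    (ha : ℓ (a * a) = 0) : a ∈ nullIdeal ℓ := by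
  let B : LinearMap.BilinForm R A := (LinearMap.mul R A).compr₂ ℓ
  have hB : LinearMap.IsSymm B := ⟨fun x y => congrArg ℓ (mul_comm x y)⟩
  exact fun b => LinearMap.congr_fun ((B.apply_apply_same_eq_zero_iff hℓ hB).1 ha) b

theorem apply_nonneg_of_isSumSq (hℓ : ∀ a, 0 ≤ ℓ (a * a)) {s : A} (hs : IsSumSq s) : 0 ≤ ℓ s := by
  induction hs with
  | zero => rw [map_zero]
  | sq_add a _ ih => rw [map_add]; exact add_nonneg (hℓ a) ih

theorem isRealIdeal_nullIdeal (hℓ : ∀ a, 0 ≤ ℓ (a * a)) : IsRealIdeal (nullIdeal ℓ) := by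
  intro a s hs has
  have hzero : ℓ (a * a) + ℓ s = 0 := by
    rw [← map_add, ← mul_one (a * a + s)]
    exact has 1
  exact mem_nullIdeal_of_apply_mul_self_eq_zero hℓ
    (by linarith [hℓ a, apply_nonneg_of_isSumSq hℓ hs])

end PositiveFunctional

section RealNullstellensatz

open Polynomial

theorem splits_of_isRealIdeal_span {p : ℝ[X]} (hp : p ≠ 0) (hI : IsRealIdeal (Ideal.span {p})) :
    p.Splits := by
  refine Splits.of_splits_map (algebraMap ℝ ℂ) (IsAlgClosed.splits _) fun z hz => ?_
  have hz : aeval z p = 0 := by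
    rwa [mem_roots_map hp, ← aeval_def] at hz
  by_contra him
  have him : z.im ≠ 0 := fun h => him ⟨z.re, Complex.ext rfl h.symm⟩
  obtain ⟨q, hq⟩ := p.quadratic_dvd_of_aeval_eq_zero_im_ne_zero hz him
  have hsq : C z.im * q * (C z.im * q) + (X - C z.re) * q * ((X - C z.re) * q) = p * q := by
    rw [hq, Complex.sq_norm, Complex.normSq_apply]
    simp only [map_add, map_mul, map_ofNat]
    ring
  have hmem : C z.im * q ∈ Ideal.span {p} :=
    hI _ _ (.mul_self _) (hsq ▸ Ideal.mul_mem_right q _ (Ideal.mem_span_singleton_self p))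
  have hdvd : p ∣ q := by
    rw [Ideal.mem_span_singleton] at hmem
    exact ((isUnit_C.2 him.isUnit).dvd_mul_left).1 hmem
  have hq0 : q ≠ 0 := by
    rintro rfl
    exact hp (by rw [hq, mul_zero])
  have hdeg : (X ^ 2 - C (2 * z.re) * X + C (‖z‖ ^ 2) : ℝ[X]).degree = 2 := by
    compute_degree!
  have hle := degree_le_of_dvd hdvd hq0
  rw [hq, degree_mul, hdeg, degree_eq_natDegree hq0] at hle
  norm_cast at hle
  omega

theorem exists_finset_mem_iff_of_isRealIdeal {I : Ideal ℝ[X]} (hI : IsRealIdeal I) (h0 : I ≠ ⊥) :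
    ∃ s : Finset ℝ, ∀ q, q ∈ I ↔ ∀ r ∈ s, q.eval r = 0 := by
  obtain ⟨p, rfl⟩ := (IsPrincipalIdealRing.principal I).principal
  have hp : p ≠ 0 := by
    rintro rfl
    simp at h0
  have hsq : Squarefree p := (isRadical_iff_span_singleton.2 hI.isRadical).squarefree hp
  have hnodup : p.roots.Nodup := nodup_roots (PerfectField.separable_iff_squarefree.2 hsq)
  have hsplits : p.Splits := splits_of_isRealIdeal_span hp hI
  refine ⟨p.roots.toFinset, fun q => ?_⟩
  rw [Ideal.submodule_span_eq, Ideal.mem_span_singleton]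
  constructor
  · rintro ⟨m, rfl⟩ r hr
    rw [eval_mul, isRoot_of_mem_roots (Multiset.mem_toFinset.1 hr), zero_mul]
  · intro hq
    rcases eq_or_ne q 0 with rfl | hq0
    · exact dvd_zero p
    · exact hsplits.dvd_of_roots_le_roots hp <| (Multiset.le_iff_subset hnodup).2 fun r hr =>
        (mem_roots hq0).2 (hq r (Multiset.mem_toFinset.2 hr))

end RealNullstellensatz

section Evaluation

variable {K : Type*} [CommSemiring K]

/-- Evaluation of Laurent polynomials at a unit, as an algebra homomorphism. -/
def evalAt (u : Kˣ) : K[T;T⁻¹] →ₐ[K] K where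
  toRingHom := LaurentPolynomial.eval₂ (RingHom.id K) u
  commutes' r := by
    rw [← LaurentPolynomial.C_eq_algebraMap]
    exact LaurentPolynomial.eval₂_C _ _ r

theorem evalAt_toLaurent (u : Kˣ) (p : Polynomial K) :
    evalAt u (Polynomial.toLaurent p) = p.eval (u : K) :=
  (LaurentPolynomial.eval₂_toLaurent _ _ p).trans Polynomial.eval₂_id

theorem evalAt_T (u : Kˣ) (n : ℤ) : evalAt u (LaurentPolynomial.T n) = ((u ^ n : Kˣ) : K) :=
  LaurentPolynomial.eval₂_T _ _ n

end Evaluation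

section LaurentRealNullstellensatz

open Polynomial

theorem exists_finset_units_mem_iff_of_isRealIdeal {J : Ideal ℝ[T;T⁻¹]} (hJ : IsRealIdeal J)
    (h0 : J ≠ ⊥) : ∃ s : Finset ℝˣ, ∀ a, a ∈ J ↔ ∀ u ∈ s, evalAt u a = 0 := by
  have hunit : ∀ (n : ℕ) (a : ℝ[T;T⁻¹]), a * LaurentPolynomial.T n ∈ J ↔ a ∈ J := fun n a =>
    J.mul_unit_mem_iff_mem (LaurentPolynomial.isUnit_T n)
  have hcomap : J.comap toLaurent ≠ ⊥ := by
    obtain ⟨a, haJ, ha⟩ := Submodule.exists_mem_ne_zero_of_ne_bot h0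
    obtain ⟨n, p, hp⟩ := a.exists_T_pow
    have hpJ : p ∈ J.comap toLaurent := by rwa [Ideal.mem_comap, hp, hunit]
    refine (Submodule.ne_bot_iff _).2 ⟨p, hpJ, ?_⟩
    rintro rfl
    rw [map_zero, eq_comm, (LaurentPolynomial.isUnit_T _).mul_left_eq_zero] at hp
    exact ha hp
  obtain ⟨s, hs⟩ := exists_finset_mem_iff_of_isRealIdeal (hJ.comap toLaurent) hcomap
  refine ⟨s.preimage Units.val Units.val_injective.injOn, fun a => ?_⟩
  obtain ⟨n, p, hp⟩ := a.exists_T_pow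
  have heval : ∀ u : ℝˣ, p.eval (u : ℝ) = 0 ↔ evalAt u a = 0 := fun u => by
    rw [← evalAt_toLaurent, hp, map_mul, evalAt_T, mul_eq_zero, or_iff_left (Units.ne_zero _)]
  have hX : X * p ∈ J.comap toLaurent ↔ a ∈ J := by
    rw [Ideal.mem_comap, map_mul, toLaurent_X, hp, mul_comm, ← Nat.cast_one, hunit, hunit]
  rw [← hX, hs]
  simp only [Finset.mem_preimage, ← heval, eval_mul, eval_X, mul_eq_zero]
  constructor
  · exact fun h u hu => (h u hu).resolve_left u.ne_zero
  · exact fun h r hr => or_iff_not_imp_left.2 fun hr0 => h (Units.mk0 r hr0) hr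

theorem weight_nonneg_of_sum_evalAt_nonneg {K : Type*} [Field K] [LinearOrder K]
    [IsStrictOrderedRing K] {s : Finset Kˣ} {w : Kˣ → K}
    (h : ∀ a, 0 ≤ ∑ u ∈ s, w u * evalAt u (a * a)) {u : Kˣ} (hu : u ∈ s) : 0 ≤ w u := by
  classical
  let p : K[X] := ∏ v ∈ s.erase u, (X - C (v : K))
  have hpu : p.eval (u : K) ≠ 0 := by
    simp only [p, eval_prod, eval_sub, eval_X, eval_C]
    refine Finset.prod_ne_zero_iff.2 fun v hv => sub_ne_zero.2 ?_
    exact fun huv => Finset.ne_of_mem_erase hv (Units.ext huv.symm)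
  have hpv : ∀ v ∈ s, v ≠ u → p.eval (v : K) = 0 := by
    intro v hv hvu
    simp only [p, eval_prod]
    exact Finset.prod_eq_zero (Finset.mem_erase.2 ⟨hvu, hv⟩) (by simp)
  have hpos := h (toLaurent p)
  simp only [map_mul, evalAt_toLaurent] at hpos
  rw [Finset.sum_eq_single_of_mem u hu fun v hv hvu => by rw [hpv v hv hvu]; ring] at hpos
  exact nonneg_of_mul_nonneg_left hpos (mul_self_pos.2 hpu)

theorem exists_eq_sum_evalAt {ℓ : ℝ[T;T⁻¹] →ₗ[ℝ] ℝ} (hℓ : ∀ a, 0 ≤ ℓ (a * a))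
    (h0 : nullIdeal ℓ ≠ ⊥) :
    ∃ (s : Finset ℝˣ) (w : ℝˣ → ℝ), (∀ u ∈ s, 0 ≤ w u) ∧
      ∀ a, ℓ a = ∑ u ∈ s, w u * evalAt u a := by
  obtain ⟨s, hs⟩ := exists_finset_units_mem_iff_of_isRealIdeal (isRealIdeal_nullIdeal hℓ) h0
  have hker : ⨅ u : s, LinearMap.ker (evalAt (u : ℝˣ)).toLinearMap ≤ LinearMap.ker ℓ := by
    intro a ha
    have ha : a ∈ nullIdeal ℓ := (hs a).2 fun u hu => (Submodule.mem_iInf _).1 ha ⟨u, hu⟩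
    simpa using ha 1
  have hspan : ℓ ∈ Submodule.span ℝ ((fun u : ℝˣ => (evalAt u).toLinearMap) '' s) := by
    rw [Set.image_eq_range]
    exact mem_span_of_iInf_ker_le_ker hker
  obtain ⟨w, rfl⟩ := (Submodule.mem_span_image_finset_iff_exists_fun' ℝ).1 hspan
  have hw : ∀ a, (∑ u ∈ s, w u • (evalAt u).toLinearMap) a = ∑ u ∈ s, w u * evalAt u a :=
    fun a => by simp
  exact ⟨s, w, fun u hu => weight_nonneg_of_sum_evalAt_nonneg (fun a => hw _ ▸ hℓ a) hu, hw⟩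

end LaurentRealNullstellensatz

theorem exists_dual_eqOn_of_inf_le_ker {K V : Type*} [Field K] [AddCommGroup V] [Module K V]
    (ℓ : V →ₗ[K] K) {E F : Submodule K V} (h : E ⊓ F ≤ LinearMap.ker ℓ) :
    ∃ ℓ' : V →ₗ[K] K, F ≤ LinearMap.ker ℓ' ∧ ∀ x ∈ E, ℓ' x = ℓ x := by
  have hℓ : ℓ ∈ (E ⊓ F).dualAnnihilator := (Submodule.mem_dualAnnihilator ℓ).2 fun x hx => h hx
  rw [Subspace.dualAnnihilator_inf_eq] at hℓ
  obtain ⟨α, hα, ℓ', hℓ', rfl⟩ := Submodule.mem_sup.1 hℓ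
  refine ⟨ℓ', fun x hx => (Submodule.mem_dualAnnihilator ℓ').1 hℓ' x hx, fun x hx => ?_⟩
  rw [LinearMap.add_apply, (Submodule.mem_dualAnnihilator α).1 hα x hx, zero_add]

/-! ### Laurent polynomials with exponents in an interval -/

section Band

variable {R : Type*} [CommSemiring R]

variable (R) in
/-- The Laurent polynomials with exponents in `[a, b]`. -/
def band (a b : ℤ) : Submodule R R[T;T⁻¹] :=
  AddMonoidAlgebra.supported R R (Set.Icc a b)

/-- The Laurent polynomials with exponents in `[a, b]` whose coefficient at `a` is `s` times the one
at `b`. -/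
def twisted (a b : ℤ) (s : R) : Submodule R R[T;T⁻¹] where
  carrier := {f | f ∈ band R a b ∧ f.coeff a = s * f.coeff b}
  add_mem' hf hg := ⟨add_mem hf.1 hg.1, by simp [hf.2, hg.2, mul_add]⟩
  zero_mem' := ⟨zero_mem _, by simp⟩
  smul_mem' r f hf := ⟨Submodule.smul_mem _ _ hf.1, by simp [hf.2, mul_left_comm]⟩

variable {a b a' b' : ℤ} {s s' : R} {f g : R[T;T⁻¹]}

theorem mem_band : f ∈ band R a b ↔ ∀ n, n < a ∨ b < n → f.coeff n = 0 := by
  simp only [band, AddMonoidAlgebra.mem_supported', Set.mem_Icc, not_and_or, not_le]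

theorem band_mono (ha : a' ≤ a) (hb : b ≤ b') : band R a b ≤ band R a' b' :=
  AddMonoidAlgebra.supported_mono (Set.Icc_subset_Icc ha hb)

theorem band_le_twisted (a b : ℤ) (s : R) : band R (a + 1) (b - 1) ≤ twisted a b s :=
  fun f hf => ⟨band_mono (by omega) (by omega) hf, by
    rw [mem_band.1 hf a (by omega), mem_band.1 hf b (by omega), mul_zero]⟩

theorem T_mem_band {i : ℤ} (ha : a ≤ i) (hb : i ≤ b) : LaurentPolynomial.T i ∈ band R a b := by
  refine mem_band.2 fun n hn => ?_
  rw [LaurentPolynomial.T_apply, if_neg (by omega)]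

theorem coeff_mul_eq_sum (f g : R[T;T⁻¹]) (n : ℤ) :
    (f * g).coeff n = f.coeff.sum fun i r => r * g.coeff (n - i) := by
  rw [AddMonoidAlgebra.coeff_mul_apply_left]
  simp only [sub_eq_neg_add]

theorem coeff_T_mul (i n : ℤ) (f : R[T;T⁻¹]) :
    (LaurentPolynomial.T i * f).coeff n = f.coeff (n - i) := by
  rw [coeff_mul_eq_sum, LaurentPolynomial.T, AddMonoidAlgebra.coeff_single,
    Finsupp.sum_single_index (zero_mul _), one_mul]

theorem mul_mem_band (hf : f ∈ band R a b) (hg : g ∈ band R a' b') :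
    f * g ∈ band R (a + a') (b + b') := by
  refine mem_band.2 fun n hn => ?_
  rw [coeff_mul_eq_sum]
  refine Finset.sum_eq_zero fun i _ => ?_
  by_cases hi : i < a ∨ b < i
  · simp [mem_band.1 hf i hi]
  · simp [mem_band.1 hg (n - i) (by omega)]

theorem coeff_mul_top (hf : f ∈ band R a b) (hg : g ∈ band R a' b') :
    (f * g).coeff (b + b') = f.coeff b * g.coeff b' := by
  rw [coeff_mul_eq_sum, Finsupp.sum_eq_single b, add_sub_cancel_left]
  · intro i _ hib
    rcases lt_or_gt_of_ne hib with hi | hi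
    · rw [mem_band.1 hg (b + b' - i) (by omega), mul_zero]
    · rw [mem_band.1 hf i (.inr hi), zero_mul]
  · rw [zero_mul]; exact fun _ => rfl

theorem coeff_mul_bot (hf : f ∈ band R a b) (hg : g ∈ band R a' b') :
    (f * g).coeff (a + a') = f.coeff a * g.coeff a' := by
  rw [coeff_mul_eq_sum, Finsupp.sum_eq_single a, add_sub_cancel_left]
  · intro i _ hia
    rcases lt_or_gt_of_ne hia with hi | hi
    · rw [mem_band.1 hf i (.inl hi), zero_mul]
    · rw [mem_band.1 hg (a + a' - i) (by omega), mul_zero]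
  · rw [zero_mul]; exact fun _ => rfl

theorem mul_mem_twisted (hf : f ∈ twisted a b s) (hg : g ∈ twisted a' b' s') :
    f * g ∈ twisted (a + a') (b + b') (s * s') :=
  ⟨mul_mem_band hf.1 hg.1, by
    rw [coeff_mul_bot hf.1 hg.1, coeff_mul_top hf.1 hg.1, hf.2, hg.2, mul_mul_mul_comm]⟩

theorem one_mem_twisted : (1 : R[T;T⁻¹]) ∈ twisted 0 0 1 :=
  ⟨LaurentPolynomial.T_zero (R := R) ▸ T_mem_band le_rfl le_rfl, (one_mul _).symm⟩

theorem pow_mem_twisted (hf : f ∈ twisted a b s) (n : ℕ) :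
    f ^ n ∈ twisted (n * a) (n * b) (s ^ n) := by
  induction n with
  | zero => simpa using one_mem_twisted
  | succ n ih => simpa only [pow_succ, Nat.cast_succ, add_one_mul] using mul_mem_twisted ih hf

theorem coeff_pow_top (hf : f ∈ twisted a b s) (n : ℕ) :
    (f ^ n).coeff (n * b) = f.coeff b ^ n := by
  induction n with
  | zero => simp [← LaurentPolynomial.T_zero, LaurentPolynomial.T_apply]
  | succ n ih =>
    rw [pow_succ, pow_succ, Nat.cast_succ, add_one_mul,
      coeff_mul_top (pow_mem_twisted hf n).1 hf.1, ih]

theorem exists_mem_twisted_coeff_eq_one (hab : a < b) (s : R) :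
    ∃ m ∈ twisted a b s, m.coeff b = 1 := by
  have hmb : (LaurentPolynomial.T b + s • LaurentPolynomial.T a : R[T;T⁻¹]) ∈ band R a b :=
    add_mem (T_mem_band hab.le le_rfl) (Submodule.smul_mem _ s (T_mem_band le_rfl hab.le))
  exact ⟨_, ⟨hmb, by simp [LaurentPolynomial.T_apply, hab.ne, hab.ne']⟩,
    by simp [LaurentPolynomial.T_apply, hab.ne]⟩

theorem exists_mem_band_coeff_ne_zero (hf : f ≠ 0) :
    ∃ a b : ℤ, f ∈ band R a b ∧ f.coeff a ≠ 0 ∧ f.coeff b ≠ 0 := by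
  have hne : f.coeff.support.Nonempty := by
    simpa only [Finsupp.support_nonempty_iff, ne_eq, AddMonoidAlgebra.coeff_eq_zero] using hf
  refine ⟨f.coeff.support.min' hne, f.coeff.support.max' hne, mem_band.2 fun n hn => ?_,
    Finsupp.mem_support_iff.1 (Finset.min'_mem _ _),
    Finsupp.mem_support_iff.1 (Finset.max'_mem _ _)⟩
  by_contra h
  have hsupp := Finsupp.mem_support_iff.2 h
  have hmin := Finset.min'_le _ _ hsupp
  have hmax := Finset.le_max' _ _ hsupp
  omega

theorem mem_Icc_of_coeff_ne_zero {n : ℤ} (hf : f ∈ band R a b) (hn : f.coeff n ≠ 0) :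
    n ∈ Set.Icc a b := by
  by_contra h
  exact hn (mem_band.1 hf n (by rw [Set.mem_Icc] at h; omega))

theorem mem_band_of_mul_mem_band [NoZeroDivisors R] (hf : f ∈ band R a b) (ha : f.coeff a ≠ 0)
    (hb : f.coeff b ≠ 0) (hfg : f * g ∈ band R (a + a') (b + b')) : g ∈ band R a' b' := by
  rcases eq_or_ne g 0 with rfl | hg
  · exact zero_mem _
  obtain ⟨i, j, hij, hi, hj⟩ := exists_mem_band_coeff_ne_zero hg
  have htop := mem_Icc_of_coeff_ne_zero hfg (coeff_mul_top hf hij ▸ mul_ne_zero hb hj)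
  have hbot := mem_Icc_of_coeff_ne_zero hfg (coeff_mul_bot hf hij ▸ mul_ne_zero ha hi)
  rw [Set.mem_Icc] at htop hbot
  exact band_mono (by omega) (by omega) hij

end Band

section BandOverField

variable {K : Type*} [Field K] {a b a' b' : ℤ} {s s' : K} {f g : K[T;T⁻¹]}

theorem mem_twisted_of_mul_mem_twisted (hs : s ≠ 0) (hf : f ∈ twisted a b s) (hb : f.coeff b ≠ 0)
    (hfg : f * g ∈ twisted (a + a') (b + b') (s * s')) : g ∈ twisted a' b' s' := by
  have ha : f.coeff a ≠ 0 := hf.2 ▸ mul_ne_zero hs hb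
  have hg : g ∈ band K a' b' := mem_band_of_mul_mem_band hf.1 ha hb hfg.1
  have hext := hfg.2
  rw [coeff_mul_bot hf.1 hg, coeff_mul_top hf.1 hg, hf.2, mul_mul_mul_comm] at hext
  exact ⟨hg, mul_left_cancel₀ (mul_ne_zero hs hb) hext⟩

theorem exists_mul_mem_twisted (hf : f ∈ band K (a + 1) (b - 1)) (hf0 : f ≠ 0) (s : K) :
    ∃ m, f * m ∈ twisted a b s ∧ (f * m).coeff b ≠ 0 := by
  obtain ⟨i, j, hij, hi, hj⟩ := exists_mem_band_coeff_ne_zero hf0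
  have hai := mem_Icc_of_coeff_ne_zero hf hi
  have hjb := mem_Icc_of_coeff_ne_zero hf hj
  rw [Set.mem_Icc] at hai hjb
  have hfij : f ∈ twisted i j (f.coeff i / f.coeff j) := ⟨hij, (div_mul_cancel₀ _ hj).symm⟩
  obtain ⟨m, hm, hm1⟩ := exists_mem_twisted_coeff_eq_one (a := a - i) (b := b - j) (by omega)
    (f.coeff j / f.coeff i * s)
  refine ⟨m, ?_, ?_⟩
  · simpa [← mul_assoc, div_mul_div_cancel₀, hi, hj] using mul_mem_twisted hfij hm
  · rw [← add_sub_cancel j b, coeff_mul_top hij hm.1, hm1, mul_one]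
    exact hj

theorem sub_smul_mem_band_left (hf : f ∈ band K a b) (hg : g ∈ band K a b) (ha : g.coeff a ≠ 0) :
    f - (f.coeff a / g.coeff a) • g ∈ band K (a + 1) b := by
  refine mem_band.2 fun n hn => ?_
  rcases eq_or_ne n a with rfl | hna
  · simp [ha]
  · simp [mem_band.1 hf n (by omega), mem_band.1 hg n (by omega)]

theorem sub_smul_mem_band_right (hf : f ∈ band K a b) (hg : g ∈ band K a b) (hb : g.coeff b ≠ 0) :
    f - (f.coeff b / g.coeff b) • g ∈ band K a (b - 1) := by
  refine mem_band.2 fun n hn => ?_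
  rcases eq_or_ne n b with rfl | hnb
  · simp [hb]
  · simp [mem_band.1 hf n (by omega), mem_band.1 hg n (by omega)]

theorem mem_band_of_coeff_eq_zero (hf : f ∈ twisted a b s) (hb : f.coeff b = 0) :
    f ∈ band K (a + 1) (b - 1) := by
  refine mem_band.2 fun n hn => ?_
  rcases eq_or_ne n a with rfl | hna
  · rw [hf.2, hb, mul_zero]
  rcases eq_or_ne n b with rfl | hnb
  · exact hb
  · exact mem_band.1 hf.1 n (by omega)

theorem twisted_eq_sup (hf : f ∈ twisted a b s) (hb : f.coeff b ≠ 0) :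
    twisted a b s = band K (a + 1) (b - 1) ⊔ Submodule.span K {f} := by
  refine le_antisymm (fun g hg => ?_) (sup_le (band_le_twisted a b s) ?_)
  · rw [← sub_add_cancel g ((g.coeff b / f.coeff b) • f)]
    have hf' := Submodule.smul_mem _ (g.coeff b / f.coeff b) hf
    refine add_mem (Submodule.mem_sup_left (mem_band_of_coeff_eq_zero (sub_mem hg hf') ?_))
      (Submodule.mem_sup_right (Submodule.smul_mem _ _ (Submodule.mem_span_singleton_self f)))
    simp [hb]
  · rwa [Submodule.span_singleton_le_iff_mem]

theorem band_le_of_mem_left {M : Submodule K K[T;T⁻¹]} (hfM : f ∈ M) (hf : f ∈ band K a b)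
    (ha : f.coeff a ≠ 0) (hM : band K (a + 1) b ≤ M) : band K a b ≤ M := fun g hg => by
  rw [← sub_add_cancel g ((g.coeff a / f.coeff a) • f)]
  exact add_mem (hM (sub_smul_mem_band_left hg hf ha)) (Submodule.smul_mem _ _ hfM)

theorem band_le_of_mem_right {M : Submodule K K[T;T⁻¹]} (hfM : f ∈ M) (hf : f ∈ band K a b)
    (hb : f.coeff b ≠ 0) (hM : band K a (b - 1) ≤ M) : band K a b ≤ M := fun g hg => by
  rw [← sub_add_cancel g ((g.coeff b / f.coeff b) • f)]
  exact add_mem (hM (sub_smul_mem_band_right hg hf hb)) (Submodule.smul_mem _ _ hfM)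

theorem band_le_of_echelon {M : Submodule K K[T;T⁻¹]} {a b : ℤ}
    (h : ∀ n ∈ Set.Icc a b, ∃ f ∈ M, f ∈ band K n b ∧ f.coeff n ≠ 0) : band K a b ≤ M := by
  rcases lt_or_ge b a with hab | hab
  · intro f hf
    have hf0 : f = 0 := LaurentPolynomial.ext fun n => mem_band.1 hf n (by omega)
    exact hf0 ▸ zero_mem M
  · obtain ⟨f, hfM, hf, hfa⟩ := h a ⟨le_rfl, hab⟩
    exact band_le_of_mem_left hfM hf hfa <|
      band_le_of_echelon fun n hn => h n (Set.Icc_subset_Icc_left (by omega) hn)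
termination_by (b + 1 - a).toNat

theorem band_le_sup_span (hf : f ∈ band K a b) (ha : f.coeff a ≠ 0) (hb : f.coeff b ≠ 0)
    (m n : ℕ) : band K (a - m) (b + n) ≤ band K a b ⊔ (Ideal.span {f}).restrictScalars K := by
  have hTf : ∀ i, LaurentPolynomial.T i * f ∈ band K a b ⊔ (Ideal.span {f}).restrictScalars K :=
    fun i => Submodule.mem_sup_right (Ideal.mul_mem_left _ _ (Ideal.mem_span_singleton_self f))
  have hT : ∀ {i a' b' : ℤ}, a' ≤ a + i → b + i ≤ b' → LaurentPolynomial.T i * f ∈ band K a' b' :=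
    fun h₁ h₂ => band_mono (by omega) (by omega) (mul_mem_band (T_mem_band le_rfl le_rfl) hf)
  induction m with
  | zero =>
    induction n with
    | zero => simp
    | succ n ih =>
      refine band_le_of_mem_right (hTf (n + 1)) (hT ?_ ?_) ?_ ?_
      · omega
      · omega
      · rw [coeff_T_mul]; simpa
      · exact (band_mono le_rfl (by omega)).trans ih
  | succ m ih =>
    refine band_le_of_mem_left (hTf (-(m + 1))) (hT ?_ ?_) ?_ ?_
    · omega
    · omega
    · rwa [coeff_T_mul, Nat.cast_succ, sub_neg_eq_add, sub_add_cancel]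
    · exact (band_mono (by omega) le_rfl).trans ih

theorem band_sup_span_eq_top (hf : f ∈ band K a b) (ha : f.coeff a ≠ 0) (hb : f.coeff b ≠ 0) :
    band K a b ⊔ (Ideal.span {f}).restrictScalars K = ⊤ := by
  refine eq_top_iff.2 fun g _ => ?_
  rcases eq_or_ne g 0 with rfl | hg
  · exact zero_mem _
  obtain ⟨i, j, hij, -, -⟩ := exists_mem_band_coeff_ne_zero hg
  exact band_le_sup_span hf ha hb (a - i).toNat (j - b).toNat
    (band_mono (by omega) (by omega) hij)

theorem exists_add_mul_eq (hs : s ≠ 0) (hss : s ≠ s') (hf : f ∈ twisted a b s) (hb : f.coeff b ≠ 0)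
    (g : K[T;T⁻¹]) : ∃ r ∈ twisted a b s', ∃ m, r + f * m = g := by
  have ha : f.coeff a ≠ 0 := hf.2 ▸ mul_ne_zero hs hb
  have hg : g ∈ band K a b ⊔ (Ideal.span {f}).restrictScalars K :=
    band_sup_span_eq_top hf.1 ha hb ▸ Submodule.mem_top
  obtain ⟨r, hr, q, hq, rfl⟩ := Submodule.mem_sup.1 hg
  obtain ⟨m, rfl⟩ := Ideal.mem_span_singleton'.1 hq
  let c : K := (r.coeff a - s' * r.coeff b) / ((s - s') * f.coeff b)
  have hc : c * ((s - s') * f.coeff b) = r.coeff a - s' * r.coeff b :=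
    div_mul_cancel₀ _ (mul_ne_zero (sub_ne_zero.2 hss) hb)
  refine ⟨r - c • f, ⟨sub_mem hr (Submodule.smul_mem _ c hf.1), ?_⟩, m + LaurentPolynomial.C c, ?_⟩
  · simp only [AddMonoidAlgebra.coeff_sub, AddMonoidAlgebra.coeff_smul, Finsupp.sub_apply,
      Finsupp.smul_apply, smul_eq_mul, hf.2]
    linear_combination -hc
  · rw [LaurentPolynomial.smul_eq_C_mul]
    ring

end BandOverField

/-! ### Functionals on Laurent polynomials and kernels of their forms -/

section KernelOn

variable {R A : Type*} [CommRing R] [CommRing A] [Algebra R A]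

/-- The kernel of the bilinear form `(f, g) ↦ Λ (f g)` on the subspace `E`. -/
def kernelOn (Λ : A →ₗ[R] R) (E : Submodule R A) : Submodule R A where
  carrier := {f | f ∈ E ∧ ∀ g ∈ E, Λ (f * g) = 0}
  add_mem' hf hf' := ⟨add_mem hf.1 hf'.1, fun g hg => by
    rw [add_mul, map_add, hf.2 g hg, hf'.2 g hg, add_zero]⟩
  zero_mem' := ⟨zero_mem E, fun g _ => by rw [zero_mul, map_zero]⟩
  smul_mem' r f hf := ⟨E.smul_mem r hf.1, fun g hg => by
    rw [smul_mul_assoc, map_smul, hf.2 g hg, smul_zero]⟩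

end KernelOn

section LeadingKernel

variable {K : Type*} [Field K] {Λ : K[T;T⁻¹] →ₗ[K] K} {a b : ℤ} {s : K}

/-- The kernel of the form `(f, g) ↦ Λ (f g)` on `twisted a b s` contains an element with nonzero
leading coefficient. -/
def HasLeadingKernel (Λ : K[T;T⁻¹] →ₗ[K] K) (a b : ℤ) (s : K) : Prop :=
  ∃ f ∈ kernelOn Λ (twisted a b s), f.coeff b ≠ 0

theorem hasLeadingKernel_of_kernelOn_ne_bot
    (hΛ : ∀ f h, f * f ∈ twisted (a + a) (b + b) (s * s) → f * h ∈ twisted (a + a) (b + b) (s * s) →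
      Λ (f * f) = 0 → Λ (f * h) = 0)
    (hker : kernelOn Λ (twisted a b s) ≠ ⊥) : HasLeadingKernel Λ a b s := by
  obtain ⟨f, ⟨hf, hfΛ⟩, hf0⟩ := Submodule.exists_mem_ne_zero_of_ne_bot hker
  rcases ne_or_eq (f.coeff b) 0 with hb | hb
  · exact ⟨f, ⟨hf, hfΛ⟩, hb⟩
  obtain ⟨m, hm, hmb⟩ := exists_mul_mem_twisted (mem_band_of_coeff_eq_zero hf hb) hf0 s
  refine ⟨f * m, ⟨hm, fun g hg => ?_⟩, hmb⟩
  rw [mul_assoc]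
  exact hΛ f (m * g) (mul_mem_twisted hf hf) (mul_assoc f m g ▸ mul_mem_twisted hm hg) (hfΛ f hf)

theorem twisted_inf_span_le_ker (hs : s ≠ 0) {f : K[T;T⁻¹]} (hf : f ∈ kernelOn Λ (twisted a b s))
    (hb : f.coeff b ≠ 0) :
    twisted (a + a) (b + b) (s * s) ⊓ (Ideal.span {f}).restrictScalars K ≤ LinearMap.ker Λ := by
  rintro _ ⟨hmem, hspan⟩
  obtain ⟨g, rfl⟩ := Ideal.mem_span_singleton.1 hspan
  exact hf.2 g (mem_twisted_of_mul_mem_twisted hs hf.1 hb hmem)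

end LeadingKernel

theorem exists_eqOn_sum_evalAt {Λ : ℝ[T;T⁻¹] →ₗ[ℝ] ℝ} {a b : ℤ} {s : ℝ} (hs : s ≠ 0)
    (hker : HasLeadingKernel Λ a b s) (hpos : ∀ g ∈ twisted a b (-s), 0 ≤ Λ (g * g)) :
    ∃ (t : Finset ℝˣ) (w : ℝˣ → ℝ), (∀ u ∈ t, 0 ≤ w u) ∧
      ∀ g ∈ twisted (a + a) (b + b) (s * s), Λ g = ∑ u ∈ t, w u * evalAt u g := by
  obtain ⟨f, hf, hb⟩ := hker
  obtain ⟨Λ', hΛ'f, hΛ'⟩ := exists_dual_eqOn_of_inf_le_ker Λ (twisted_inf_span_le_ker hs hf hb)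
  have hnull : ∀ g, Λ' (f * g) = 0 := fun g =>
    hΛ'f (Ideal.mul_mem_right g _ (Ideal.mem_span_singleton_self f))
  have hΛ'pos : ∀ g, 0 ≤ Λ' (g * g) := fun g => by
    obtain ⟨r, hr, m, rfl⟩ := exists_add_mul_eq hs (self_ne_neg.2 hs) hf.1 hb g
    have hexpand : (r + f * m) * (r + f * m) = r * r + f * (m * (2 * r + f * m)) := by ring
    rw [hexpand, map_add, hnull, add_zero, hΛ' _ (neg_mul_neg s s ▸ mul_mem_twisted hr hr)]
    exact hpos r hr
  have hne : nullIdeal Λ' ≠ ⊥ := (Submodule.ne_bot_iff _).2 ⟨f, hnull, by rintro rfl; simp at hb⟩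
  obtain ⟨t, w, hw, hΛ'eq⟩ := exists_eq_sum_evalAt hΛ'pos hne
  exact ⟨t, w, hw, fun g hg => (hΛ' g hg).symm.trans (hΛ'eq g)⟩

/-! ### Ranks of symmetric bilinear forms -/

section Rank

variable {K E : Type*} [Field K] [AddCommGroup E] [Module K E] [FiniteDimensional K E]
  {B : LinearMap.BilinForm K E}

theorem rank_eq_rank_restrict_iff (hB : LinearMap.IsSymm B) (U : Submodule K E) :
    LinearMap.rank B = LinearMap.rank (B.restrict U) ↔ U ⊔ LinearMap.ker B = ⊤ := by
  have hrange : LinearMap.range (B.restrict U) = (U.map B).map U.subtype.dualMap := by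
    rw [← LinearMap.range_domRestrict U B, ← LinearMap.range_comp]
    rfl
  rw [LinearMap.rank, LinearMap.rank, hrange, ← Module.finrank_eq_rank, ← Module.finrank_eq_rank,
    Nat.cast_inj, ← top_le_iff, ← LinearMap.map_le_map_iff, Submodule.map_top]
  constructor
  · intro hrank
    have hle : U.map B ≤ LinearMap.range B := LinearMap.map_le_range
    exact (Submodule.eq_of_le_of_finrank_le hle
      (hrank ▸ Submodule.finrank_map_le U.subtype.dualMap (U.map B))).ge
  · intro hle
    have hmap : U.map B = LinearMap.range B := le_antisymm LinearMap.map_le_range hle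
    have hinj : Function.Injective (U.subtype.dualMap.domRestrict (LinearMap.range B)) := by
      refine (injective_iff_map_eq_zero _).2 ?_
      rintro ⟨_, v, rfl⟩ hv
      refine Subtype.ext (LinearMap.ext fun x => ?_)
      obtain ⟨u, hu, hux⟩ := hle (LinearMap.mem_range_self B x)
      have hvu : B v u = 0 := LinearMap.congr_fun hv ⟨u, hu⟩
      change B v x = 0
      rw [← hB.eq, ← hux, hB.eq]
      exact hvu
    rw [hmap, ← LinearMap.range_domRestrict, LinearMap.finrank_range_of_inj hinj]

theorem rank_eq_rank_restrict_ker_iff (hB : LinearMap.IsSymm B) {φ : E →ₗ[K] K} (hφ : φ ≠ 0) :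
    LinearMap.rank B = LinearMap.rank (B.restrict (LinearMap.ker φ)) ↔
      ∃ v ∈ LinearMap.ker B, φ v ≠ 0 := by
  have hcoatom := LinearMap.isCoatom_ker_of_surjective (LinearMap.surjective hφ)
  rw [rank_eq_rank_restrict_iff hB, ← codisjoint_iff, ← hcoatom.not_le_iff_codisjoint,
    SetLike.not_le_iff_exists]
  rfl

end Rank

/-! ### The parametrization of the curve -/

section Curve

variable {c : Polynomial ℝ} {k : ℕ}

theorem coeff_zero_ne_zero (hirr : Irreducible (curvePoly c)) : c.coeff 0 ≠ 0 := by
  intro h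
  obtain ⟨q, rfl⟩ := Polynomial.X_dvd_iff.2 h
  have hfactor : curvePoly (Polynomial.X * q) = MvPolynomial.X 0 *
      (MvPolynomial.X 1 - Polynomial.aeval (MvPolynomial.X 0) q) := by
    rw [curvePoly, map_mul, Polynomial.aeval_X, mul_sub]
  rcases hirr.isUnit_or_isUnit hfactor with hunit | hunit
  · simpa using (hunit.map (MvPolynomial.eval (0 : Fin 2 → ℝ))).ne_zero
  · refine (hunit.map (MvPolynomial.eval ![0, q.eval 0])).ne_zero ?_
    rw [map_sub, ← MvPolynomial.coe_aeval_eq_eval, RingHom.coe_coe,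
      ← Polynomial.aeval_algHom_apply]
    simp [Polynomial.aeval_def, Polynomial.coeff_zero_eq_eval_zero]

theorem mem_curve_iff {z : Fin 2 → ℝ} : z ∈ curve c ↔ z 0 * z 1 = c.eval (z 0) := by
  have h : MvPolynomial.eval z (Polynomial.aeval (MvPolynomial.X 0) c) = c.eval (z 0) := by
    rw [← MvPolynomial.coe_aeval_eq_eval, RingHom.coe_coe, ← Polynomial.aeval_algHom_apply]
    simp [Polynomial.aeval_def, Polynomial.eval₂_id]
  simp only [curve, curvePoly, Set.mem_ofPred_eq, map_sub, map_mul, MvPolynomial.eval_X, h,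
    sub_eq_zero]

theorem exists_units_param_eq (h0 : c.coeff 0 ≠ 0) {z : Fin 2 → ℝ} (hz : z ∈ curve c) :
    ∃ u : ℝˣ, ![(u : ℝ), c.eval (u : ℝ) * (u : ℝ)⁻¹] = z := by
  rw [mem_curve_iff] at hz
  have hz0 : z 0 ≠ 0 := by
    intro h
    rw [h, zero_mul, ← Polynomial.coeff_zero_eq_eval_zero] at hz
    exact h0 hz.symm
  refine ⟨Units.mk0 (z 0) hz0, ?_⟩
  ext i
  fin_cases i
  · rfl
  · simp [← hz, mul_right_comm, hz0]

theorem Phi_resMap (p : MvPolynomial (Fin 2) ℝ) : Phi c (resMap (curve c) p) = preParam c p := rfl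

theorem Phi_injective (h0 : c.coeff 0 ≠ 0) : Function.Injective (Phi c) := by
  refine (injective_iff_map_eq_zero _).2 fun f hf => ?_
  obtain ⟨p, rfl⟩ := Ideal.Quotient.mkₐ_surjective ℝ (vanIdeal (curve c)) f
  refine Ideal.Quotient.eq_zero_iff_mem.2 (MvPolynomial.mem_vanishingIdeal_iff.2 fun z hz => ?_)
  obtain ⟨u, rfl⟩ := exists_units_param_eq h0 hz
  rw [MvPolynomial.aeval_eq_eval]
  rw [Phi_resMap] at hf
  exact (eval_preParam c u p).symm.trans (by rw [hf, map_zero])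

theorem Phi_xC_pow (c : Polynomial ℝ) (j : ℕ) : Phi c (xC c ^ j) = LaurentPolynomial.T j := by
  rw [map_pow, xC, Phi_resMap, preParam, MvPolynomial.aeval_X, Matrix.cons_val_zero,
    LaurentPolynomial.T_pow, mul_one]

theorem Phi_yC_pow (c : Polynomial ℝ) (j : ℕ) : Phi c (yC c ^ j) = cDivT c ^ j := by
  rw [map_pow, yC, Phi_resMap, preParam, MvPolynomial.aeval_X, Matrix.cons_val_one,
    Matrix.cons_val_fin_one]

theorem dDivT_eq (c : Polynomial ℝ) (k : ℕ) :
    dDivT c k = cDivT c ^ k - (2 : ℝ) • LaurentPolynomial.T (2 * k : ℤ) := by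
  have htwo : Polynomial.toLaurent (2 : Polynomial ℝ) = (2 : ℝ[T;T⁻¹]) := map_ofNat _ 2
  have hexp : ((3 * k : ℕ) : ℤ) + -(k : ℤ) = 2 * k := by push_cast; ring
  rw [dDivT, cDivT, map_sub, map_mul, map_pow, htwo, Polynomial.toLaurent_X_pow, mul_pow,
    LaurentPolynomial.T_pow, sub_mul, LaurentPolynomial.smul_eq_C_mul, map_ofNat, mul_neg_one,
    mul_assoc 2, ← LaurentPolynomial.T_add, hexp]

theorem Phi_yC_pow_sub (c : Polynomial ℝ) (k : ℕ) :
    Phi c (yC c ^ k - 2 * xC c ^ (2 * k)) = dDivT c k := by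
  rw [dDivT_eq, map_sub, map_mul, map_ofNat, Phi_yC_pow, Phi_xC_pow,
    LaurentPolynomial.smul_eq_C_mul, map_ofNat, Nat.cast_mul, Nat.cast_two]

theorem eq_cubic (hc : c.Monic) (hd : c.natDegree = 3) :
    c = Polynomial.X ^ 3 + Polynomial.C (c.coeff 2) * Polynomial.X ^ 2 +
      Polynomial.C (c.coeff 1) * Polynomial.X + Polynomial.C (c.coeff 0) := by
  have h3 : c.coeff 3 = 1 := hd ▸ hc
  conv_lhs => rw [c.as_sum_range_C_mul_X_pow, hd]
  simp only [Finset.sum_range_succ, Finset.sum_range_zero, h3, map_one]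
  ring

theorem cDivT_eq (hc : c.Monic) (hd : c.natDegree = 3) :
    cDivT c = LaurentPolynomial.T 2 + c.coeff 2 • LaurentPolynomial.T 1 +
      c.coeff 1 • LaurentPolynomial.T 0 + c.coeff 0 • LaurentPolynomial.T (-1) := by
  rw [cDivT]
  conv_lhs => rw [eq_cubic hc hd]
  simp only [map_add, map_mul, map_pow, Polynomial.toLaurent_C, Polynomial.toLaurent_X,
    LaurentPolynomial.T_pow, LaurentPolynomial.smul_eq_C_mul, add_mul,
    LaurentPolynomial.mul_T_assoc, ← LaurentPolynomial.T_add]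
  norm_num

theorem cDivT_mem_twisted (hc : c.Monic) (hd : c.natDegree = 3) :
    cDivT c ∈ twisted (-1) 2 (c.coeff 0) := by
  rw [cDivT_eq hc hd]
  refine ⟨add_mem (add_mem (add_mem ?_ ?_) ?_) ?_, ?_⟩
  iterate 4 first
    | exact T_mem_band (by norm_num) (by norm_num)
    | exact Submodule.smul_mem _ _ (T_mem_band (by norm_num) (by norm_num))
  simp [-LaurentPolynomial.T_zero, LaurentPolynomial.T_apply]

theorem coeff_cDivT (hc : c.Monic) (hd : c.natDegree = 3) : (cDivT c).coeff 2 = 1 := by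
  simp [-LaurentPolynomial.T_zero, cDivT_eq hc hd, LaurentPolynomial.T_apply]

theorem cDivT_pow_mem_twisted (hc : c.Monic) (hd : c.natDegree = 3) (k : ℕ) :
    cDivT c ^ k ∈ twisted (-k) (2 * k) (c.coeff 0 ^ k) := by
  simpa only [mul_neg_one, mul_comm (2 : ℤ)] using pow_mem_twisted (cDivT_mem_twisted hc hd) k

theorem coeff_cDivT_pow (hc : c.Monic) (hd : c.natDegree = 3) (k : ℕ) :
    (cDivT c ^ k).coeff (2 * k) = 1 := by
  rw [mul_comm, coeff_pow_top (cDivT_mem_twisted hc hd), coeff_cDivT hc hd, one_pow]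

theorem coeff_dDivT (hc : c.Monic) (hd : c.natDegree = 3) (k : ℕ) :
    (dDivT c k).coeff (2 * k) = -1 := by
  rw [dDivT_eq, AddMonoidAlgebra.coeff_sub, Finsupp.sub_apply, coeff_cDivT_pow hc hd,
    AddMonoidAlgebra.coeff_smul, Finsupp.smul_apply, LaurentPolynomial.T_apply, if_pos rfl]
  norm_num

theorem dDivT_mem_twisted (hc : c.Monic) (hd : c.natDegree = 3) (hk : 1 ≤ k) :
    dDivT c k ∈ twisted (-k) (2 * k) (-c.coeff 0 ^ k) := by
  have hpow := cDivT_pow_mem_twisted hc hd k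
  refine ⟨?_, ?_⟩
  · rw [dDivT_eq]
    exact sub_mem hpow.1 (Submodule.smul_mem _ _ (T_mem_band (by omega) le_rfl))
  · have hT : (LaurentPolynomial.T (2 * k) : ℝ[T;T⁻¹]).coeff (-k) = 0 := by
      rw [LaurentPolynomial.T_apply, if_neg (by omega)]
    rw [coeff_dDivT hc hd, dDivT_eq, AddMonoidAlgebra.coeff_sub, Finsupp.sub_apply, hpow.2,
      coeff_cDivT_pow hc hd, AddMonoidAlgebra.coeff_smul, Finsupp.smul_apply, hT, smul_zero,
      sub_zero, mul_one, neg_mul_neg, mul_one]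

variable (c k) in
/-- The Laurent polynomials `c/t, …, (c/t)^{k-1}, 1, t, …, t^{2k-1}` common to `basisQ` and
`basisR`. -/
def innerBasis : Set ℝ[T;T⁻¹] :=
  {f | ∃ j : ℕ, 1 ≤ j ∧ j < k ∧ f = cDivT c ^ j} ∪
    {f | ∃ j : ℕ, j < 2 * k ∧ f = LaurentPolynomial.T (j : ℤ)}

theorem innerBasis_subset_band (hc : c.Monic) (hd : c.natDegree = 3) :
    innerBasis c k ⊆ band ℝ (-k + 1) (2 * k - 1) := by
  rintro f (⟨j, -, hj, rfl⟩ | ⟨j, hj, rfl⟩)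
  · exact band_mono (by omega) (by omega) (cDivT_pow_mem_twisted hc hd j).1
  · exact T_mem_band (by omega) (by omega)

theorem notMem_innerBasis (hc : c.Monic) (hd : c.natDegree = 3) {f : ℝ[T;T⁻¹]}
    (hf : f.coeff (2 * k) ≠ 0) : f ∉ innerBasis c k := fun hmem =>
  hf (mem_band.1 (innerBasis_subset_band hc hd hmem) _ (.inr (by omega)))

theorem span_innerBasis (hc : c.Monic) (hd : c.natDegree = 3) (h0 : c.coeff 0 ≠ 0) :
    Submodule.span ℝ (innerBasis c k) = band ℝ (-k + 1) (2 * k - 1) := by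
  refine le_antisymm (Submodule.span_le.2 (innerBasis_subset_band hc hd))
    (band_le_of_echelon fun n hn => ?_)
  rw [Set.mem_Icc] at hn
  rcases lt_or_ge n 0 with hneg | hnonneg
  · obtain ⟨j, rfl⟩ : ∃ j : ℕ, n = -j := ⟨n.natAbs, by omega⟩
    have hpow := cDivT_pow_mem_twisted hc hd j
    refine ⟨cDivT c ^ j, Submodule.subset_span (.inl ⟨j, by omega, by omega, rfl⟩),
      band_mono le_rfl (by omega) hpow.1, ?_⟩
    rw [hpow.2, coeff_cDivT_pow hc hd, mul_one]
    exact pow_ne_zero j h0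
  · lift n to ℕ using hnonneg
    exact ⟨LaurentPolynomial.T n, Submodule.subset_span (.inr ⟨n, by omega, rfl⟩),
      T_mem_band le_rfl hn.2, by simp [LaurentPolynomial.T_apply]⟩

theorem basisQ_diff (hc : c.Monic) (hd : c.natDegree = 3) (hk : 1 ≤ k) :
    basisQ c k \ {cDivT c ^ k} = innerBasis c k := by
  have hinsert : basisQ c k = insert (cDivT c ^ k) (innerBasis c k) := by
    ext f
    simp only [basisQ, innerBasis, Set.mem_union, Set.mem_insert_iff, Set.mem_ofPred_eq, ← or_assoc]
    refine or_congr_left ⟨?_, ?_⟩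
    · rintro ⟨j, hj, hjk, rfl⟩
      rcases hjk.eq_or_lt with rfl | hjk
      · exact .inl rfl
      · exact .inr ⟨j, hj, hjk, rfl⟩
    · rintro (rfl | ⟨j, hj, hjk, rfl⟩)
      · exact ⟨k, hk, le_rfl, rfl⟩
      · exact ⟨j, hj, hjk.le, rfl⟩
  rw [hinsert, Set.insert_sdiff_self_of_notMem]
  exact notMem_innerBasis hc hd (by simp [coeff_cDivT_pow hc hd])

theorem basisR_diff (hc : c.Monic) (hd : c.natDegree = 3) :
    basisR c k \ {dDivT c k} = innerBasis c k := by
  rw [basisR, Set.union_assoc]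
  change insert (dDivT c k) (innerBasis c k) \ {dDivT c k} = _
  rw [Set.insert_sdiff_self_of_notMem]
  exact notMem_innerBasis hc hd (by simp [coeff_dDivT hc hd])

theorem innerBasis_subset_range_Phi : innerBasis c k ⊆ Set.range (Phi c) := by
  rintro f (⟨j, -, -, rfl⟩ | ⟨j, -, rfl⟩)
  · exact ⟨_, Phi_yC_pow c j⟩
  · exact ⟨_, Phi_xC_pow c j⟩

theorem map_Phi_span_preimage_innerBasis (hc : c.Monic) (hd : c.natDegree = 3)
    (h0 : c.coeff 0 ≠ 0) :
    (Submodule.span ℝ (Phi c ⁻¹' innerBasis c k)).map (Phi c).toLinearMap =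
      band ℝ (-k + 1) (2 * k - 1) := by
  rw [Submodule.map_span, AlgHom.coe_toLinearMap,
    Set.image_preimage_eq_of_subset innerBasis_subset_range_Phi, span_innerBasis hc hd h0]

theorem map_Phi_Uk (hc : c.Monic) (hd : c.natDegree = 3) (h0 : c.coeff 0 ≠ 0) (hk : 1 ≤ k) :
    (Uk c k).map (Phi c).toLinearMap = band ℝ (-k + 1) (2 * k - 1) := by
  rw [Uk, basisQ_diff hc hd hk, map_Phi_span_preimage_innerBasis hc hd h0]

theorem map_Phi_Wk (hc : c.Monic) (hd : c.natDegree = 3) (h0 : c.coeff 0 ≠ 0) :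
    (Wk c k).map (Phi c).toLinearMap = band ℝ (-k + 1) (2 * k - 1) := by
  rw [Wk, basisR_diff hc hd, map_Phi_span_preimage_innerBasis hc hd h0]

theorem Phi_surjective (hc : c.Monic) (hd : c.natDegree = 3) (h0 : c.coeff 0 ≠ 0) :
    Function.Surjective (Phi c) := by
  intro g
  rcases eq_or_ne g 0 with rfl | hg
  · exact ⟨0, map_zero _⟩
  obtain ⟨a, b, hab, -, -⟩ := exists_mem_band_coeff_ne_zero hg
  have hmem : g ∈ (Wk c (a.natAbs + b.natAbs + 1)).map (Phi c).toLinearMap := by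
    rw [map_Phi_Wk hc hd h0]
    exact band_mono (by omega) (by omega) hab
  obtain ⟨f, -, hf⟩ := hmem
  exact ⟨f, hf⟩

end Curve

/-! ### The images of the two spaces -/

section Spaces

variable {c : Polynomial ℝ} {k a b : ℕ}

theorem Phi_monomial_mem_band (hc : c.Monic) (hd : c.natDegree = 3) (hab : a + b ≤ k)
    (hb : b < k) : Phi c (xC c ^ a * yC c ^ b) ∈ band ℝ (-k + 1) (2 * k - 1) := by
  rw [map_mul, Phi_xC_pow, Phi_yC_pow]
  exact band_mono (by omega) (by omega)
    (mul_mem_band (T_mem_band le_rfl le_rfl) (cDivT_pow_mem_twisted hc hd b).1)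

theorem monomial_eq_yC_pow_iff (hc : c.Monic) (hd : c.natDegree = 3) (hab : a + b ≤ k) :
    xC c ^ a * yC c ^ b = yC c ^ k ↔ b = k := by
  refine ⟨fun heq => ?_, ?_⟩
  · by_contra hb
    have hband := Phi_monomial_mem_band hc hd hab (by omega)
    rw [heq, Phi_yC_pow] at hband
    have hcoeff := mem_band.1 hband (2 * k) (by omega)
    rw [coeff_cDivT_pow hc hd] at hcoeff
    exact one_ne_zero hcoeff
  · rintro rfl
    obtain rfl : a = 0 := by omega
    rw [pow_zero, one_mul]

variable (c k) in
/-- The span of the monomials `x^a y^b`, `a ≤ 2`, `a + b ≤ k`, other than `y^k`. -/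
def innerSpan : Submodule ℝ (CoordRing (curve c)) :=
  Submodule.span ℝ (basisSet c k \ {yC c ^ k})

theorem Vk_eq_sup (c : Polynomial ℝ) (k : ℕ) :
    Vk c k = innerSpan c k ⊔ Submodule.span ℝ {yC c ^ k - 2 * xC c ^ (2 * k)} :=
  Submodule.span_union _ _

theorem monomial_reduction (hc : c.Monic) (hd : c.natDegree = 3) (a b : ℕ) :
    xC c ^ (a + 3) * yC c ^ b = xC c ^ (a + 1) * yC c ^ (b + 1)
      - c.coeff 2 • (xC c ^ (a + 2) * yC c ^ b) - c.coeff 1 • (xC c ^ (a + 1) * yC c ^ b)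
      - c.coeff 0 • (xC c ^ a * yC c ^ b) := by
  have h3 : c.coeff 3 = 1 := hd ▸ hc
  have hcubic : xC c * yC c = c.coeff 0 • xC c ^ 0 + c.coeff 1 • xC c ^ 1 + c.coeff 2 • xC c ^ 2
      + xC c ^ 3 := by
    rw [xC_mul_yC, Polynomial.aeval_eq_sum_range, hd]
    simp only [Finset.sum_range_succ, Finset.sum_range_zero, h3, one_smul, zero_add]
  have hxy : xC c ^ (a + 1) * yC c ^ (b + 1) = xC c * yC c * (xC c ^ a * yC c ^ b) := by ring
  rw [hxy, hcubic]
  simp only [add_mul, smul_mul_assoc]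
  ring_nf

theorem monomial_mem_innerSpan (hc : c.Monic) (hd : c.natDegree = 3) (hab : a + b ≤ k)
    (hb : b < k) : xC c ^ a * yC c ^ b ∈ innerSpan c k := by
  induction a using Nat.strong_induction_on generalizing b with
  | _ a ih =>
    rcases le_or_gt a 2 with ha | ha
    · exact Submodule.subset_span
        ⟨⟨a, b, ha, hab, rfl⟩, fun h => hb.ne ((monomial_eq_yC_pow_iff hc hd hab).1 h)⟩
    obtain ⟨a, rfl⟩ := Nat.exists_eq_add_of_le' ha
    rw [monomial_reduction hc hd]
    refine sub_mem (sub_mem (sub_mem ?_ ?_) ?_) ?_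
    · exact ih _ (by omega) (by omega) (by omega)
    all_goals exact Submodule.smul_mem _ _ (ih _ (by omega) (by omega) hb)

theorem coordLE_eq_span (c : Polynomial ℝ) (k : ℕ) :
    CoordLE (curve c) k =
      Submodule.span ℝ {f | ∃ a b : ℕ, a + b ≤ k ∧ f = xC c ^ a * yC c ^ b} := by
  refine le_antisymm ?_ (Submodule.span_le.2 ?_)
  · rw [CoordLE, PolyLE, MvPolynomial.restrictTotalDegree, MvPolynomial.restrictSupport_eq_span,
      Submodule.map_span]
    refine Submodule.span_mono ?_
    rintro _ ⟨_, ⟨n, hn, rfl⟩, rfl⟩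
    refine ⟨n 0, n 1, by simpa [Finsupp.sum_fintype] using hn, ?_⟩
    simp [MvPolynomial.monomial_eq, Finsupp.prod_fintype, xC, yC]
  · rintro _ ⟨a, b, hab, rfl⟩
    exact monomial_mem_coordLE c hab

theorem coordLE_eq_sup (hc : c.Monic) (hd : c.natDegree = 3) :
    CoordLE (curve c) k = innerSpan c k ⊔ Submodule.span ℝ {yC c ^ k} := by
  refine le_antisymm ?_ (sup_le (Submodule.span_le.2 ?_) ?_)
  · rw [coordLE_eq_span, Submodule.span_le]
    rintro _ ⟨a, b, hab, rfl⟩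
    rcases eq_or_ne b k with hb | hb
    · rw [(monomial_eq_yC_pow_iff hc hd hab).2 hb]
      exact Submodule.mem_sup_right (Submodule.mem_span_singleton_self _)
    · exact Submodule.mem_sup_left (monomial_mem_innerSpan hc hd hab (by omega))
  · rintro _ ⟨⟨a, b, -, hab, rfl⟩, -⟩
    exact monomial_mem_coordLE c hab
  · rw [Submodule.span_singleton_le_iff_mem]
    simpa using monomial_mem_coordLE c (zero_add k).le

theorem map_Phi_innerSpan_le (hc : c.Monic) (hd : c.natDegree = 3) :
    (innerSpan c k).map (Phi c).toLinearMap ≤ band ℝ (-k + 1) (2 * k - 1) := by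
  rw [innerSpan, Submodule.map_span_le]
  rintro _ ⟨⟨a, b, -, hab, rfl⟩, hne⟩
  have hb : b ≠ k := mt (monomial_eq_yC_pow_iff hc hd hab).2 hne
  exact Phi_monomial_mem_band hc hd hab (by omega)

theorem xC_pow_mem_innerSpan (hc : c.Monic) (hd : c.natDegree = 3) {j : ℕ} (hj : j < 2 * k) :
    xC c ^ j ∈ innerSpan c k := by
  have hmem := xC_pow_mem c hc hd k j hj
  rw [coordLE_eq_sup hc hd] at hmem
  obtain ⟨f, hf, _, hr, hsum⟩ := Submodule.mem_sup.1 hmem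
  obtain ⟨r, rfl⟩ := Submodule.mem_span_singleton.1 hr
  have hband : Phi c f ∈ band ℝ (-k + 1) (2 * k - 1) :=
    map_Phi_innerSpan_le hc hd (Submodule.mem_map_of_mem hf)
  have hr0 : r = 0 := by
    have hcoeff := congrArg (fun g => (Phi c g).coeff (2 * k)) hsum
    simpa [Phi_yC_pow, Phi_xC_pow, coeff_cDivT_pow hc hd, LaurentPolynomial.T_apply,
      mem_band.1 hband (2 * k) (by omega), show (j : ℤ) ≠ 2 * k by omega] using hcoeff
  rwa [← hsum, hr0, zero_smul, add_zero]

theorem map_Phi_innerSpan (hc : c.Monic) (hd : c.natDegree = 3) (h0 : c.coeff 0 ≠ 0) :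
    (innerSpan c k).map (Phi c).toLinearMap = band ℝ (-k + 1) (2 * k - 1) := by
  refine le_antisymm (map_Phi_innerSpan_le hc hd) ?_
  rw [← span_innerBasis hc hd h0, Submodule.span_le]
  rintro _ (⟨j, -, hj, rfl⟩ | ⟨j, hj, rfl⟩)
  · refine ⟨yC c ^ j, ?_, Phi_yC_pow c j⟩
    simpa using monomial_mem_innerSpan hc hd ((zero_add j).trans_le hj.le) hj
  · exact ⟨xC c ^ j, xC_pow_mem_innerSpan hc hd hj, Phi_xC_pow c j⟩

theorem map_Phi_sup_span (hc : c.Monic) (hd : c.natDegree = 3) (h0 : c.coeff 0 ≠ 0) {s : ℝ}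
    {f : CoordRing (curve c)} (hf : Phi c f ∈ twisted (-k) (2 * k) s)
    (hb : (Phi c f).coeff (2 * k) ≠ 0) :
    (innerSpan c k ⊔ Submodule.span ℝ {f}).map (Phi c).toLinearMap = twisted (-k) (2 * k) s := by
  rw [Submodule.map_sup, map_Phi_innerSpan hc hd h0, Submodule.map_span, Set.image_singleton,
    AlgHom.toLinearMap_apply, twisted_eq_sup hf hb]

theorem map_Phi_coordLE (hc : c.Monic) (hd : c.natDegree = 3) (h0 : c.coeff 0 ≠ 0) (k : ℕ) :
    (CoordLE (curve c) k).map (Phi c).toLinearMap = twisted (-k) (2 * k) (c.coeff 0 ^ k) := by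
  rw [coordLE_eq_sup hc hd]
  refine map_Phi_sup_span hc hd h0 ?_ ?_ <;> rw [Phi_yC_pow]
  · exact cDivT_pow_mem_twisted hc hd k
  · simp [coeff_cDivT_pow hc hd]

theorem map_Phi_Vk (hc : c.Monic) (hd : c.natDegree = 3) (h0 : c.coeff 0 ≠ 0) (hk : 1 ≤ k) :
    (Vk c k).map (Phi c).toLinearMap = twisted (-k) (2 * k) (-c.coeff 0 ^ k) := by
  rw [Vk_eq_sup]
  refine map_Phi_sup_span hc hd h0 ?_ ?_ <;> rw [Phi_yC_pow_sub]
  · exact dDivT_mem_twisted hc hd hk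
  · simp [coeff_dDivT hc hd]

instance (S : Set (Fin 2 → ℝ)) (k : ℕ) :
    FiniteDimensional ℝ (CoordLE S k) :=
  Module.Finite.of_surjective _ (resLE_surjective S k)

instance (c : Polynomial ℝ) (k : ℕ) : FiniteDimensional ℝ (Vk c k) := by
  have hle : Vk c k ≤ CoordLE (curve c) (2 * k) := by
    have hy := monomial_mem_coordLE c (show 0 + k ≤ 2 * k by omega)
    have hx := monomial_mem_coordLE c (show 2 * k + 0 ≤ 2 * k by omega)
    rw [Vk, Submodule.span_le]
    rintro _ (⟨⟨a, b, -, hab, rfl⟩, -⟩ | rfl)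
    · exact monomial_mem_coordLE c (by omega)
    · simpa [two_mul (xC c ^ (2 * k))] using sub_mem hy (add_mem hx hx)
  exact Submodule.finiteDimensional_of_le hle

end Spaces

/-! ### Transfer of the bilinear forms -/

section Transfer

variable {R A : Type*} [CommRing R] [Algebra ℝ R] [CommRing A] [Algebra ℝ A] {Φ : R →ₐ[ℝ] A}
  {Λ : A →ₗ[ℝ] ℝ} {V : Submodule ℝ R} {E : Submodule ℝ A} {B : LinearMap.BilinForm ℝ V}

theorem squarePositive_iff (hV : V.map Φ.toLinearMap = E) (hB : ∀ g h : V, B g h = Λ (Φ g * Φ h)) :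
    SquarePositive B ↔ ∀ g ∈ E, 0 ≤ Λ (g * g) := by
  subst hV
  constructor
  · rintro hpos _ ⟨g, hg, rfl⟩
    rcases eq_or_ne g 0 with rfl | hg0
    · simp
    · exact (hpos ⟨g, hg⟩ (by simpa using hg0)).trans_eq (hB _ _)
  · intro hpos g _
    rw [hB]
    exact hpos _ (Submodule.mem_map_of_mem g.2)

theorem ker_eq_comap_kernelOn (hV : V.map Φ.toLinearMap = E)
    (hB : ∀ g h : V, B g h = Λ (Φ g * Φ h)) :
    LinearMap.ker B = (kernelOn Λ E).comap (Φ.toLinearMap ∘ₗ V.subtype) := by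
  subst hV
  ext f
  constructor
  · intro hf
    refine ⟨Submodule.mem_map_of_mem f.2, ?_⟩
    rintro _ ⟨g, hg, rfl⟩
    exact (hB f ⟨g, hg⟩).symm.trans (LinearMap.congr_fun hf _)
  · intro hf
    exact LinearMap.ext fun g => (hB f g).trans (hf.2 _ (Submodule.mem_map_of_mem g.2))

theorem isSymm_of_apply_eq (hB : ∀ g h : V, B g h = Λ (Φ g * Φ h)) : LinearMap.IsSymm B :=
  ⟨fun g h => by rw [RingHom.id_apply, hB, hB, mul_comm]⟩

theorem formKer_eq_ker {M : Type*} [AddCommGroup M] [Module ℝ M] {B : LinearMap.BilinForm ℝ M}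
    (hB : LinearMap.IsSymm B) : formKer B = LinearMap.ker B := by
  rw [formKer, show LinearMap.flip B = B from LinearMap.ext₂ fun g h => hB.eq h g]

theorem formKer_eq_bot (hΦ : Function.Injective Φ) (hV : V.map Φ.toLinearMap = E)
    (hB : ∀ g h : V, B g h = Λ (Φ g * Φ h)) (hker : kernelOn Λ E = ⊥) : formKer B = ⊥ := by
  rw [formKer_eq_ker (isSymm_of_apply_eq hB), ker_eq_comap_kernelOn hV hB, hker,
    Submodule.comap_bot, LinearMap.ker_eq_bot]
  exact hΦ.comp V.injective_subtype

end Transfer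

theorem formRank_eq_formRank_formRestrict_iff {R : Type*} [CommRing R] [Algebra ℝ R]
    {Φ : R →ₐ[ℝ] ℝ[T;T⁻¹]} {Λ : ℝ[T;T⁻¹] →ₗ[ℝ] ℝ} {V U : Submodule ℝ R} [FiniteDimensional ℝ V]
    {B : LinearMap.BilinForm ℝ V} {a b : ℤ} {s : ℝ} (hab : a < b) (hΦ : Function.Injective Φ)
    (hV : V.map Φ.toLinearMap = twisted a b s) (hU : U.map Φ.toLinearMap = band ℝ (a + 1) (b - 1))
    (hB : ∀ g h : V, B g h = Λ (Φ g * Φ h)) :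
    formRank B = formRank (formRestrict B U) ↔ HasLeadingKernel Λ a b s := by
  have hΦV : ∀ v : V, Φ v ∈ twisted a b s := fun v => hV ▸ Submodule.mem_map_of_mem v.2
  let φ : V →ₗ[ℝ] ℝ := Finsupp.lapply b ∘ₗ (AddMonoidAlgebra.coeffLinearEquiv ℝ).toLinearMap ∘ₗ
    Φ.toLinearMap ∘ₗ V.subtype
  have hφ : φ ≠ 0 := by
    obtain ⟨_, hm, hmb⟩ := exists_mem_twisted_coeff_eq_one hab s
    obtain ⟨v, hv, rfl⟩ := hV ▸ hm
    exact fun h => one_ne_zero (hmb.symm.trans (LinearMap.congr_fun h ⟨v, hv⟩))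
  have hker : U.comap V.subtype = LinearMap.ker φ := by
    ext v
    have hmem : Φ v ∈ U.map Φ.toLinearMap ↔ (v : R) ∈ U := hΦ.mem_set_image
    rw [Submodule.mem_comap, V.subtype_apply, ← hmem, hU]
    exact ⟨fun h => mem_band.1 h b (by omega), mem_band_of_coeff_eq_zero (hΦV v)⟩
  rw [formRank, formRank, formRestrict, hker,
    rank_eq_rank_restrict_ker_iff (isSymm_of_apply_eq hB) hφ, ker_eq_comap_kernelOn hV hB]
  constructor
  · rintro ⟨v, hv, hvb⟩
    exact ⟨Φ v, hv, hvb⟩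
  · rintro ⟨_, hf, hfb⟩
    obtain ⟨v, hv, rfl⟩ := hV ▸ hf.1
    exact ⟨⟨v, hv⟩, hf, hfb⟩

section CurveForms

variable {c : Polynomial ℝ} {n k : ℕ}

theorem exists_laurent_functional (h0 : c.coeff 0 ≠ 0) (ℓ : CoordLE (curve c) n →ₗ[ℝ] ℝ) :
    ∃ Λ : ℝ[T;T⁻¹] →ₗ[ℝ] ℝ, ∀ f (hf : f ∈ CoordLE (curve c) n), Λ (Phi c f) = ℓ ⟨f, hf⟩ := by
  obtain ⟨ψ, hψ⟩ := LinearMap.exists_leftInverse_of_injective (Phi c).toLinearMap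
    (LinearMap.ker_eq_bot.2 (Phi_injective h0))
  obtain ⟨ℓ', hℓ⟩ := LinearMap.exists_extend ℓ
  refine ⟨ℓ' ∘ₗ ψ, fun f hf => ?_⟩
  have hψf : ψ (Phi c f) = f := LinearMap.congr_fun hψ f
  rw [LinearMap.comp_apply, hψf, ← hℓ]
  rfl

theorem localForm_one_apply {ℓ : CoordLE (curve c) n →ₗ[ℝ] ℝ} {Λ : ℝ[T;T⁻¹] →ₗ[ℝ] ℝ}
    (hΛ : ∀ f (hf : f ∈ CoordLE (curve c) n), Λ (Phi c f) = ℓ ⟨f, hf⟩)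
    {V : Submodule ℝ (CoordRing (curve c))}
    (hV : ∀ g ∈ V, ∀ h ∈ V, 1 * (g * h) ∈ CoordLE (curve c) n) (g h : V) :
    localForm ℓ V 1 hV g h = Λ (Phi c g * Phi c h) := by
  rw [← map_mul, ← one_mul ((g : CoordRing (curve c)) * h)]
  exact (hΛ _ (hV g g.2 h h.2)).symm

theorem formKer_polyForm {S : Set (Fin 2 → ℝ)} (L : PolyLE (2 * k) →ₗ[ℝ] ℝ)
    (hL : VanishesOnIdeal S L) :
    formKer (polyForm L) = (formKer (coordForm (inducedFunctional L hL))).comap (resLE S k) := by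
  have happly : ∀ p q : PolyLE k, polyForm L p q =
      coordForm (inducedFunctional L hL) (resLE S k p) (resLE S k q) := by
    intro p q
    refine (inducedFunctional_resLE L hL _).symm.trans ?_
    exact congrArg _ (Subtype.ext ((map_mul (resMap S) _ _).trans (one_mul _).symm))
  ext q
  constructor
  · refine fun hq => LinearMap.ext fun f => ?_
    obtain ⟨p, rfl⟩ := resLE_surjective S k f
    exact (happly p q).symm.trans (LinearMap.congr_fun hq p)
  · exact fun hq => LinearMap.ext fun p => (happly p q).trans (LinearMap.congr_fun hq _)

theorem isNonsingular_of_formKer_eq_bot (hc : c.Monic) (hd : c.natDegree = 3) (hk : 1 ≤ k)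
    {L : PolyLE (2 * k) →ₗ[ℝ] ℝ} {hL : VanishesOnIdeal (curve c) L}
    (hQ : formKer (coordForm (inducedFunctional L hL)) = ⊥)
    (hR : formKer (VkForm hc hd hk (inducedFunctional L hL)) = ⊥) :
    IsNonsingular hc hd hk L hL := by
  refine ⟨?_, hR⟩
  rw [formKer_polyForm L hL, hQ, Submodule.comap_bot, ker_resLE]

end CurveForms

/-! ### Moment functionals -/

section Moment

open MeasureTheory

variable {S : Set (Fin 2 → ℝ)} {m : ℕ} {L : PolyLE m →ₗ[ℝ] ℝ}

theorem integrable_and_apply_eq_integral (hL : VanishesOnIdeal S L) {μ : Measure (Fin 2 → ℝ)}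
    (hS : μ Sᶜ = 0)
    (hμ : ∀ p : PolyLE m,
      Integrable (fun z => MvPolynomial.eval z (p : MvPolynomial (Fin 2) ℝ)) μ ∧
      L p = ∫ z, MvPolynomial.eval z (p : MvPolynomial (Fin 2) ℝ) ∂μ)
    (p : MvPolynomial (Fin 2) ℝ) (hp : resMap S p ∈ CoordLE S m) :
    Integrable (fun z => MvPolynomial.eval z p) μ ∧
      inducedFunctional L hL ⟨resMap S p, hp⟩ = ∫ z, MvPolynomial.eval z p ∂μ := by
  obtain ⟨q, hq, hqp⟩ := id hp
  have hmem : q - p ∈ vanIdeal S := Ideal.Quotient.eq.1 hqp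
  have hae : (fun z => MvPolynomial.eval z q) =ᵐ[μ] fun z => MvPolynomial.eval z p := by
    have hS' : ∀ᵐ z ∂μ, z ∈ S := hS
    filter_upwards [hS'] with z hz
    have hvanish := MvPolynomial.mem_vanishingIdeal_iff.1 hmem z hz
    rwa [MvPolynomial.aeval_eq_eval, map_sub, sub_eq_zero] at hvanish
  obtain ⟨hint, heq⟩ := hμ ⟨q, hq⟩
  refine ⟨hint.congr hae, ?_⟩
  rw [← integral_congr_ae hae, ← heq, ← inducedFunctional_resLE L hL]
  exact congrArg _ (Subtype.ext hqp.symm)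

theorem IsMomentFunctional.apply_mul_self_nonneg (hM : IsMomentFunctional S L)
    (hL : VanishesOnIdeal S L) (f : CoordRing S) (hf : f * f ∈ CoordLE S m) :
    0 ≤ inducedFunctional L hL ⟨f * f, hf⟩ := by
  obtain ⟨μ, hS, hμ⟩ := hM
  obtain ⟨p, rfl⟩ := Ideal.Quotient.mk_surjective f
  refine le_of_le_of_eq (integral_nonneg fun z => ?_)
    (integrable_and_apply_eq_integral hL hS hμ (p * p) hf).2.symm
  rw [map_mul]
  exact mul_self_nonneg _

theorem IsMomentFunctional.apply_mul_eq_zero (hM : IsMomentFunctional S L)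
    (hL : VanishesOnIdeal S L) (f h : CoordRing S) (hf : f * f ∈ CoordLE S m)
    (hfh : f * h ∈ CoordLE S m) (hzero : inducedFunctional L hL ⟨f * f, hf⟩ = 0) :
    inducedFunctional L hL ⟨f * h, hfh⟩ = 0 := by
  obtain ⟨μ, hS, hμ⟩ := hM
  obtain ⟨p, rfl⟩ := Ideal.Quotient.mk_surjective f
  obtain ⟨q, rfl⟩ := Ideal.Quotient.mk_surjective h
  obtain ⟨hint, hpp⟩ := integrable_and_apply_eq_integral hL hS hμ (p * p) hf
  have hpq := (integrable_and_apply_eq_integral hL hS hμ (p * q) hfh).2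
  have hnonneg : 0 ≤ fun z => MvPolynomial.eval z (p * p) := fun z =>
    (mul_self_nonneg (MvPolynomial.eval z p)).trans_eq (map_mul _ p p).symm
  have hae := (integral_eq_zero_iff_of_nonneg hnonneg hint).1 (hpp.symm.trans hzero)
  refine hpq.trans (integral_eq_zero_of_ae ?_)
  filter_upwards [hae] with z hz
  rw [map_mul, Pi.zero_apply, mul_self_eq_zero] at hz
  rw [map_mul, hz, zero_mul, Pi.zero_apply]

theorem isMomentFunctional_of_eq_sum {ι : Type*} (t : Finset ι) (z : ι → Fin 2 → ℝ)
    (hz : ∀ i ∈ t, z i ∈ S) (w : ι → ℝ) (hw : ∀ i ∈ t, 0 ≤ w i)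
    (h : ∀ p : PolyLE m, L p =
      ∑ i ∈ t, w i * MvPolynomial.eval (z i) (p : MvPolynomial (Fin 2) ℝ)) :
    IsMomentFunctional S L := by
  have hint : ∀ g : (Fin 2 → ℝ) → ℝ, ∀ i ∈ t,
      Integrable g (ENNReal.ofReal (w i) • Measure.dirac (z i)) := fun g i _ =>
    (integrable_dirac (by simp)).smul_measure ENNReal.ofReal_ne_top
  refine ⟨∑ i ∈ t, ENNReal.ofReal (w i) • Measure.dirac (z i), ?_, fun p => ⟨?_, ?_⟩⟩
  · rw [Measure.finsetSum_apply]
    refine Finset.sum_eq_zero fun i hi => ?_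
    rw [Measure.smul_apply, Measure.dirac_apply, Set.indicator_of_notMem (by simpa using hz i hi),
      smul_zero]
  · exact integrable_finsetSum_measure.2 (hint _)
  · rw [integral_finsetSum_measure (hint _), h]
    refine Finset.sum_congr rfl fun i hi => ?_
    rw [integral_smul_measure, integral_dirac, ENNReal.toReal_ofReal (hw i hi), smul_eq_mul]

end Moment

section MomentOnCurve

variable {c : Polynomial ℝ} {m : ℕ} {L : PolyLE m →ₗ[ℝ] ℝ} {hL : VanishesOnIdeal (curve c) L}
  {Λ : ℝ[T;T⁻¹] →ₗ[ℝ] ℝ} {E : Submodule ℝ ℝ[T;T⁻¹]}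

theorem IsMomentFunctional.laurent_apply_mul_self_nonneg (hM : IsMomentFunctional (curve c) L)
    (hΛ : ∀ f (hf : f ∈ CoordLE (curve c) m), Λ (Phi c f) = inducedFunctional L hL ⟨f, hf⟩)
    (hΦ : Function.Bijective (Phi c)) (hE : (CoordLE (curve c) m).map (Phi c).toLinearMap = E)
    (f : ℝ[T;T⁻¹]) (hf : f * f ∈ E) : 0 ≤ Λ (f * f) := by
  subst hE
  obtain ⟨f, rfl⟩ := hΦ.2 f
  rw [← map_mul] at hf ⊢
  have hff : f * f ∈ CoordLE (curve c) m := hΦ.1.mem_set_image.1 hf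
  exact (hM.apply_mul_self_nonneg hL f hff).trans_eq (hΛ _ hff).symm

theorem IsMomentFunctional.laurent_apply_mul_eq_zero (hM : IsMomentFunctional (curve c) L)
    (hΛ : ∀ f (hf : f ∈ CoordLE (curve c) m), Λ (Phi c f) = inducedFunctional L hL ⟨f, hf⟩)
    (hΦ : Function.Bijective (Phi c)) (hE : (CoordLE (curve c) m).map (Phi c).toLinearMap = E)
    (f h : ℝ[T;T⁻¹]) (hf : f * f ∈ E) (hfh : f * h ∈ E) (hzero : Λ (f * f) = 0) :
    Λ (f * h) = 0 := by
  subst hE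
  obtain ⟨f, rfl⟩ := hΦ.2 f
  obtain ⟨h, rfl⟩ := hΦ.2 h
  rw [← map_mul] at hf hfh hzero ⊢
  have hff : f * f ∈ CoordLE (curve c) m := hΦ.1.mem_set_image.1 hf
  have hfh' : f * h ∈ CoordLE (curve c) m := hΦ.1.mem_set_image.1 hfh
  rw [hΛ _ hff] at hzero
  rw [hΛ _ hfh']
  exact hM.apply_mul_eq_zero hL f h hff hfh' hzero

theorem isMomentFunctional_of_eq_sum_evalAt
    (hΛ : ∀ f (hf : f ∈ CoordLE (curve c) m), Λ (Phi c f) = inducedFunctional L hL ⟨f, hf⟩)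
    (hE : (CoordLE (curve c) m).map (Phi c).toLinearMap = E)
    (h : ∃ (t : Finset ℝˣ) (w : ℝˣ → ℝ), (∀ u ∈ t, 0 ≤ w u) ∧
      ∀ g ∈ E, Λ g = ∑ u ∈ t, w u * evalAt u g) :
    IsMomentFunctional (curve c) L := by
  subst hE
  obtain ⟨t, w, hw, hsum⟩ := h
  refine isMomentFunctional_of_eq_sum t (fun u => ![(u : ℝ), c.eval (u : ℝ) * (u : ℝ)⁻¹])
    (fun u _ => curve_param_mem c u) w hw fun p => ?_
  have hp := (resLE (curve c) m p).2
  have hL_eq : L p = Λ (Phi c (resLE (curve c) m p)) :=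
    (inducedFunctional_resLE L hL p).symm.trans (hΛ _ hp).symm
  refine (hL_eq.trans (hsum _ (Submodule.mem_map_of_mem hp))).trans ?_
  refine Finset.sum_congr rfl fun u _ => congrArg _ ?_
  rw [← eval_preParam]
  exact congrArg _ (Phi_resMap _)

end MomentOnCurve

theorem map_Phi_coordLE_two_mul {c : Polynomial ℝ} (hc : c.Monic) (hd : c.natDegree = 3)
    (h0 : c.coeff 0 ≠ 0) (k : ℕ) :
    (CoordLE (curve c) (2 * k)).map (Phi c).toLinearMap =
      twisted (-k + -k) (2 * k + 2 * k) (c.coeff 0 ^ k * c.coeff 0 ^ k) := by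
  rw [map_Phi_coordLE hc hd h0, ← pow_add, ← two_mul]
  congr 1 <;> push_cast <;> ring

theorem kernelOn_ne_bot_or_of_not_isNonsingular {c : Polynomial ℝ} {hc : c.Monic}
    {hd : c.natDegree = 3} {k : ℕ} {hk : 1 ≤ k} {L : PolyLE (2 * k) →ₗ[ℝ] ℝ}
    {hL : VanishesOnIdeal (curve c) L} (h0 : c.coeff 0 ≠ 0)
    (hsing : ¬ IsNonsingular hc hd hk L hL) {Λ : ℝ[T;T⁻¹] →ₗ[ℝ] ℝ}
    (hΛ : ∀ f (hf : f ∈ CoordLE (curve c) (2 * k)),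
      Λ (Phi c f) = inducedFunctional L hL ⟨f, hf⟩) :
    kernelOn Λ (twisted (-k) (2 * k) (c.coeff 0 ^ k)) ≠ ⊥ ∨
      kernelOn Λ (twisted (-k) (2 * k) (-c.coeff 0 ^ k)) ≠ ⊥ := by
  contrapose! hsing
  exact isNonsingular_of_formKer_eq_bot hc hd hk
    (formKer_eq_bot (Phi_injective h0) (map_Phi_coordLE hc hd h0 k)
      (localForm_one_apply hΛ one_mul_mul_mem_coordLE) hsing.1)
    (formKer_eq_bot (Phi_injective h0) (map_Phi_Vk hc hd h0 hk)
      (localForm_one_apply hΛ (one_mul_mul_mem_of_Vk c hc hd hk)) hsing.2)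

end CubicTMP

end

open CubicTMP in
theorem theorem5p2 (c : Polynomial ℝ) (hc : c.Monic) (hd : c.natDegree = 3)
    (hirr : Irreducible (CubicTMP.curvePoly c)) (k : ℕ) (hk : 1 ≤ k)
    (L : CubicTMP.PolyLE (2 * k) →ₗ[ℝ] ℝ)
    (hL : CubicTMP.VanishesOnIdeal (CubicTMP.curve c) L)
    (hsing : ¬ CubicTMP.IsNonsingular hc hd hk L hL) :
    CubicTMP.IsMomentFunctional (CubicTMP.curve c) L ↔
      CubicTMP.SquarePositive (CubicTMP.coordForm (CubicTMP.inducedFunctional L hL)) ∧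
      CubicTMP.SquarePositive (CubicTMP.VkForm hc hd hk (CubicTMP.inducedFunctional L hL)) ∧
      (CubicTMP.formRank (CubicTMP.coordForm (CubicTMP.inducedFunctional L hL)) =
          CubicTMP.formRank (CubicTMP.formRestrict
            (CubicTMP.coordForm (CubicTMP.inducedFunctional L hL)) (CubicTMP.Uk c k)) ∨
        CubicTMP.formRank (CubicTMP.VkForm hc hd hk (CubicTMP.inducedFunctional L hL)) =
          CubicTMP.formRank (CubicTMP.formRestrict
            (CubicTMP.VkForm hc hd hk (CubicTMP.inducedFunctional L hL)) (CubicTMP.Wk c k))) := by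
  have h0 := coeff_zero_ne_zero hirr
  obtain ⟨Λ, hΛ⟩ := exists_laurent_functional h0 (inducedFunctional L hL)
  have hγ : c.coeff 0 ^ k ≠ 0 := pow_ne_zero k h0
  have hΦ : Function.Bijective (Phi c) := ⟨Phi_injective h0, Phi_surjective hc hd h0⟩
  have hQ := map_Phi_coordLE hc hd h0 k
  have hR := map_Phi_Vk hc hd h0 hk
  have hQR := map_Phi_coordLE_two_mul hc hd h0 k
  have hBQ := localForm_one_apply hΛ (one_mul_mul_mem_coordLE (k := k))
  have hBR := localForm_one_apply hΛ (one_mul_mul_mem_of_Vk c hc hd hk)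
  rw [coordForm, VkForm, squarePositive_iff hQ hBQ, squarePositive_iff hR hBR,
    formRank_eq_formRank_formRestrict_iff (by omega) hΦ.1 hQ (map_Phi_Uk hc hd h0 hk) hBQ,
    formRank_eq_formRank_formRestrict_iff (by omega) hΦ.1 hR (map_Phi_Wk hc hd h0) hBR]
  constructor
  · intro hM
    have hpos := hM.laurent_apply_mul_self_nonneg hΛ hΦ hQR
    have hnull := hM.laurent_apply_mul_eq_zero hΛ hΦ hQR
    exact ⟨fun g hg => hpos g (mul_mem_twisted hg hg),
      fun g hg => hpos g (neg_mul_neg (c.coeff 0 ^ k) _ ▸ mul_mem_twisted hg hg),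
      (kernelOn_ne_bot_or_of_not_isNonsingular h0 hsing hΛ).imp
        (hasLeadingKernel_of_kernelOn_ne_bot hnull)
        (hasLeadingKernel_of_kernelOn_ne_bot (by rwa [neg_mul_neg]))⟩
  · rintro ⟨hposQ, hposR, hker | hker⟩ <;> refine isMomentFunctional_of_eq_sum_evalAt hΛ hQR ?_
    · exact exists_eqOn_sum_evalAt hγ hker hposR
    · simpa using exists_eqOn_sum_evalAt (neg_ne_zero.2 hγ) hker (by rwa [neg_neg])
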